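/- Let $n\ge 0$ and let $\mathrm{LC}_n$ be the class of upper semicontinuous functions $f:\mathbb R^n\to[0,\infty)$, not identically $0$, that are log-concave, i.e. $f((1-\lambda)x+\lambda y)\ge f(x)^{1-\lambda}f(y)^{\lambda}$ for all $x,y\in\mathbb R^n$ and $0\le\lambda\le1$. For $f,g\in\mathrm{LC}_n$ and $\alpha>0$ put $$(\alpha\cdot f)(x)=f(x/\alpha)^{\alpha},\qquad (f\star g)(x)=\sup_{y\in\mathbb R^n}f(y)g(x-y)\in[0,\infty],\qquad h_f(y)=\sup_{x\in\mathbb R^n}\bigl(\langle x,y\rangle+\log f(x)\bigr)\in(-\infty,\infty],$$ with $\log 0=-\infty$. Let $K_f=\overline{\{x: f(x)>0\}}$, and for a nonempty set $K\subseteq\mathbb R^n$ let $h_K(\theta)=\sup_{x\in K}\langle x,\theta\rangle$ for $\theta\in S^{n-1}$. A functional $F:\mathrm{LC}_n\to(-\infty,\infty]$ is called linear if $F((\alpha\cdot f)\star(\beta\cdot g))=\alpha F(f)+\beta F(g)$ for all $f,g\in\mathrm{LC}_n$ and $\alpha,\beta>0$ such that $(\alpha\cdot f)\star(\beta\cdot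 g)\in\mathrm{LC}_n$, and increasing if $f\ge g$ pointwise implies $F(f)\ge F(g)$. **Theorem.** Let $F:\mathrm{LC}_n\to(-\infty,\infty]$ be linear and increasing. Assume further that: 1. there is $f_0\in\mathrm{LC}_n$ with $\int f_0>0$ (possibly infinite) and $F(f_0)<\infty$; 2. for every sequence $f_1\le f_2\le\cdots$ in $\mathrm{LC}_n$ converging pointwise to some $f\in\mathrm{LC}_n$, one has $F(f_i)\to F(f)$ in $(-\infty,\infty]$. Then there is exactly one pair $(\mu,\nu)$, where $\mu$ is a (positive) finite Borel measure on $\mathbb R^n$ with $\int|x|\,d\mu<\infty$ and $\nu$ is a (positive) finite Borel measure on $S^{n-1}$, such that $$F(f)=\int_{\mathbb R^n}h_f\,d\mu+\int_{S^{n-1}}h_{K_f}\,d\nu\qquad\text{for all } f\in\mathrm{LC}_n.\tag{$*$}$$ Conversely, for all such $\mu$ and $\nu$, the right-hand side of $(*)$ defines a functional $F$ with values in $(-\infty,\infty]$ that is linear, increasing and satisfies 1 and 2; moreover, the linearity identity also holds when $(\alpha\cdot f)\star(\beta\cdot g)$ is replaced by its upper semicontinuous hull, whenever that hull belongs to $\mathrm{LC}_n$.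 -/

import Mathlib

open MeasureTheory Filter Topology
open scoped NNReal ENNReal

noncomputable section

namespace LogConcaveRiesz

/-- Euclidean space `ℝⁿ`. -/
abbrev E (n : ℕ) : Type := EuclideanSpace ℝ (Fin n)

/-- The unit sphere `S^{n-1}` of `ℝⁿ`. -/
abbrev S (n : ℕ) : Type := Metric.sphere (0 : E n) 1

/-- The class `LC_n` of upper semicontinuous log-concave functions `f : ℝⁿ → [0, ∞)`
which are not identically zero. -/
structure LC (n : ℕ) where
  toFun : E n → ℝ≥0
  exists_ne_zero : ∃ x, toFun x ≠ 0
  log_concave : ∀ x y : E n, ∀ t : ℝ, 0 ≤ t → t ≤ 1 →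
    toFun x ^ (1 - t) * toFun y ^ t ≤ toFun ((1 - t) • x + t • y)
  upper_semicontinuous : UpperSemicontinuous toFun

instance (n : ℕ) : CoeFun (LC n) (fun _ => E n → ℝ≥0) := ⟨LC.toFun⟩

variable {n : ℕ}

/-- The dilation `(c · f)(x) = f (x / c) ^ c`, for `c > 0`. -/
def dilate (c : ℝ) (f : E n → ℝ≥0) : E n → ℝ≥0 := fun x => f (c⁻¹ • x) ^ c

/-- The sup-convolution `(f ⋆ g)(x) = sup_y f(y) g(x - y)`, with values in `[0, ∞]`. -/
def supConv (f g : E n → ℝ≥0) : E n → ℝ≥0∞ := fun x => ⨆ y : E n, ((f y * g (x - y) : ℝ≥0) : ℝ≥0∞)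

/-- The upper semicontinuous hull of a function (the limsup includes the point itself). -/
def uscHull (u : E n → ℝ≥0∞) : E n → ℝ≥0∞ := fun x => limsup u (𝓝 x)

/-- Linearity with respect to sup-convolution:
`F ((α · f) ⋆ (β · g)) = α F(f) + β F(g)` whenever `(α · f) ⋆ (β · g)` belongs to `LC_n`
(here `h` is that element of `LC_n`). -/
def IsSupLinear (F : LC n → EReal) : Prop :=
  ∀ f g h : LC n, ∀ α β : ℝ, 0 < α → 0 < β →
    (∀ x, (h x : ℝ≥0∞) = supConv (dilate α f) (dilate β g) x) →
      F h = (α : EReal) * F f + (β : EReal) * F g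

/-- The same property for the closed sup-convolution, in which `(α · f) ⋆ (β · g)` is replaced
by its upper semicontinuous hull. If `(α · f) ⋆ (β · g)` is already in `LC_n` it equals its hull,
so this property implies `IsSupLinear`. -/
def IsClosedSupLinear (F : LC n → EReal) : Prop :=
  ∀ f g h : LC n, ∀ α β : ℝ, 0 < α → 0 < β →
    (∀ x, (h x : ℝ≥0∞) = uscHull (supConv (dilate α f) (dilate β g)) x) →
      F h = (α : EReal) * F f + (β : EReal) * F g

/-- `F` is increasing with respect to the pointwise order. -/
def IsIncreasing (F : LC n → EReal) : Prop :=
  ∀ f g : LC n, (∀ x, g x ≤ f x) → F g ≤ F f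

/-- `F (f i) → F f` whenever `f i ↑ f` pointwise, with `f` in `LC_n`. -/
def IsContinuousFromBelow (F : LC n → EReal) : Prop :=
  ∀ (u : ℕ → LC n) (f : LC n), (∀ x, Monotone fun i => u i x) →
    (∀ x, Tendsto (fun i => u i x) atTop (𝓝 (f x))) →
      Tendsto (fun i => F (u i)) atTop (𝓝 (F f))

/-- The Legendre transform `φ*(y) = sup_x (⟨x, y⟩ - φ(x))`. -/
def legendre (φ : E n → EReal) : E n → EReal :=
  fun y => ⨆ x : E n, ((inner ℝ x y : ℝ) : EReal) - φ x

/-- The support function `h_f = (-log f)*` of a log-concave function (with `-log 0 = ∞`). -/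
def supportFun (f : LC n) : E n → EReal :=
  legendre fun x => -ENNReal.log (f x : ℝ≥0∞)

/-- The support `K_f`, the closure of `{f > 0}`. -/
def suppSet (f : LC n) : Set (E n) := closure {x | 0 < f x}

/-- The support function `h_K` of a set `K`, on the unit sphere. -/
def setSupportFun (K : Set (E n)) : S n → EReal :=
  fun θ => ⨆ x ∈ K, ((inner ℝ x (θ : E n) : ℝ) : EReal)

/-- The integral `∫ φ⁺ dμ - ∫ φ⁻ dμ` of an extended-real function. If both parts have infinite
integral the value is `⊥`, so a value `≠ ⊥` means that the negative part has finite integral. -/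
def eintegral {X : Type*} [MeasurableSpace X] (μ : Measure X) (φ : X → EReal) : EReal :=
  ((∫⁻ x, (φ x).toENNReal ∂μ : ℝ≥0∞) : EReal) - ((∫⁻ x, (-φ x).toENNReal ∂μ : ℝ≥0∞) : EReal)

/-- `f ↦ ∫ h_f dμ + ∫ h_{K_f} dν`. -/
def rieszFunctional (μ : Measure (E n)) (ν : Measure (S n)) (f : LC n) : EReal :=
  eintegral μ (supportFun f) + eintegral ν (setSupportFun (suppSet f))

end LogConcaveRiesz

end

noncomputable section
namespace LogConcaveRiesz
variable {n : ℕ}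

/-! ### Log-concave functions attached to compact convex sets -/

/-! Both terms of the representation come from one object, the support function `persp f y s` of the
hypograph of `log f` in ℝⁿ × ℝ, for directions `(y, s)` with `s ≥ 0`: `s = 1` gives `h_f`, and `s =
0` gives `h_{K_f}`. It is positively homogeneous, so it is known from one point on each ray. The
points `(q, 1 - ‖q‖)`, with `q` in the closed unit ball `Q`, form a compact cross-section whose
interior represents ℝⁿ and whose boundary represents the sphere. A pair `(μ, ν)` with the stated
moment condition is thus the same as one finite measure `M` on `Q`, and the functional is `∫
ballSupport f dM` (`rieszFunctional_eq`).

The converse follows from properties of the integrand: it is linear under sup-convolution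
(`persp_sup_linear`), monotone, compatible with increasing limits (`persp_eq_iSup`), and bounded
below for each `f`, so integration reduces to the nonnegative case.

For existence, `F` is restricted to the functions of compact convex sets `C` in ℝⁿ × ℝ. Their
support functions on `Q` are continuous, Minkowski combinations become exact sup-convolutions
(`Body.toLC_comb`), and an inequality of support functions on `Q` implies the inequality of the
functions (`Body.le_toLC_of_ballSupport_le`). Hypothesis 1 makes `F` finite there. Hence `F` is an
additive, increasing function of the support function. Hahn-Banach extends it to a positive
functional on `C(Q)`, and Riesz-Markov supplies `M`. Every `f` is an increasing limit of such
functions, so continuity from below on both sides gives the formula in general.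

Uniqueness holds because differences of support functions form a dense sublattice of `C(Q)`
(`closure_supp_sub_supp`). -/

theorem LC.log_le {f : LC n} {x y : E n} (hx : 0 < f x) (hy : 0 < f y) {t : ℝ} (h0 : 0 ≤ t)
    (h1 : t ≤ 1) : 0 < f ((1 - t) • x + t • y) ∧
      (1 - t) * Real.log (f x) + t * Real.log (f y) ≤ Real.log (f ((1 - t) • x + t • y)) := by
  have h := f.log_concave x y t h0 h1
  have hpos : 0 < f x ^ (1 - t) * f y ^ t := mul_pos (NNReal.rpow_pos hx) (NNReal.rpow_pos hy)
  refine ⟨hpos.trans_le h, ?_⟩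
  have hx' : (0 : ℝ) < f x := by exact_mod_cast hx
  have hy' : (0 : ℝ) < f y := by exact_mod_cast hy
  have h2 : ((f x : ℝ)) ^ (1 - t) * (f y : ℝ) ^ t ≤ f ((1 - t) • x + t • y) := by
    exact_mod_cast h
  have h3 := Real.log_le_log (by positivity) h2
  rwa [Real.log_mul (by positivity) (by positivity), Real.log_rpow hx', Real.log_rpow hy'] at h3

/-- A nonempty compact convex subset of `ℝⁿ × ℝ`. -/
structure Body (n : ℕ) where
  carrier : Set (E n × ℝ)
  convex : Convex ℝ carrier
  isCompact : IsCompact carrier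
  nonempty : carrier.Nonempty

/-- The function `x ↦ sup {exp t : (x, t) ∈ C}`. -/
def roof (C : Set (E n × ℝ)) (x : E n) : ℝ≥0 :=
  sSup {r : ℝ≥0 | ∃ t : ℝ, (x, t) ∈ C ∧ r = (Real.exp t).toNNReal}

theorem roof_cases {C : Set (E n × ℝ)} (hC : IsCompact C) (x : E n) :
    (∃ t, (x, t) ∈ C ∧ (∀ s, (x, s) ∈ C → s ≤ t) ∧ (roof C x : ℝ) = Real.exp t) ∨
      ((∀ t, (x, t) ∉ C) ∧ roof C x = 0) := by
  by_cases h : ∃ t, (x, t) ∈ C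
  · left
    have hK : IsCompact {t : ℝ | (x, t) ∈ C} := by
      have : {t : ℝ | (x, t) ∈ C} = Prod.snd '' (C ∩ Prod.fst ⁻¹' {x}) := by
        ext t
        simp only [Set.mem_ofPred_eq, Set.mem_image, Set.mem_inter_iff, Set.mem_preimage,
          Set.mem_singleton_iff, Prod.exists]
        exact ⟨fun h => ⟨x, t, ⟨h, rfl⟩, rfl⟩, by rintro ⟨a, b, ⟨hb, rfl⟩, rfl⟩; exact hb⟩
      rw [this]
      exact (hC.inter_right (isClosed_singleton.preimage continuous_fst)).image continuous_snd
    obtain ⟨t, ht, hmax⟩ := hK.exists_isGreatest h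
    refine ⟨t, ht, fun s hs => hmax hs, ?_⟩
    have : IsGreatest {r : ℝ≥0 | ∃ t : ℝ, (x, t) ∈ C ∧ r = (Real.exp t).toNNReal}
        (Real.exp t).toNNReal := by
      refine ⟨⟨t, ht, rfl⟩, ?_⟩
      rintro _ ⟨s, hs, rfl⟩
      exact Real.toNNReal_le_toNNReal (Real.exp_le_exp.2 (hmax hs))
    rw [roof, this.csSup_eq, Real.coe_toNNReal _ (Real.exp_pos t).le]
  · right
    push Not at h
    refine ⟨h, ?_⟩
    -- Over a point outside the projection of `C` the set is empty, and its supremum in `ℝ≥0` is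
    -- `0`.
    simp [roof, h]

theorem exp_le_roof {C : Set (E n × ℝ)} (hC : IsCompact C) {x : E n} {t : ℝ} (h : (x, t) ∈ C) :
    Real.exp t ≤ roof C x := by
  rcases roof_cases hC x with ⟨s, -, hs, h'⟩ | ⟨h', -⟩
  · rw [h']; exact Real.exp_le_exp.2 (hs t h)
  · exact absurd h (h' t)

theorem log_roof_mem {C : Set (E n × ℝ)} (hC : IsCompact C) {x : E n} (h : 0 < roof C x) :
    (x, Real.log (roof C x)) ∈ C := by
  rcases roof_cases hC x with ⟨s, hs, -, h'⟩ | ⟨-, h'⟩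
  · rwa [h', Real.log_exp]
  · simp [h'] at h

/-- The log-concave function `x ↦ sup {exp t : (x, t) ∈ C}` of a compact convex set `C`. -/
def Body.toLC (C : Body n) : LC n where
  toFun := roof C.carrier
  exists_ne_zero := by
    obtain ⟨⟨x, t⟩, h⟩ := C.nonempty
    refine ⟨x, fun h0 => ?_⟩
    have := exp_le_roof C.isCompact h
    rw [h0] at this
    exact absurd this (not_le.2 (Real.exp_pos t))
  log_concave x y t h0 h1 := by
    -- The endpoints are treated apart: since `0 ^ 0 = 1`, a zero value kills the product only when
    -- its exponent is nonzero.
    rcases h0.eq_or_lt with rfl | h0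
    · simp
    rcases h1.eq_or_lt with rfl | h1
    · simp
    rcases (show 0 ≤ roof C.carrier x from zero_le).eq_or_lt with hx | hx
    · rw [← hx, NNReal.zero_rpow (by linarith)]; simp
    rcases (show 0 ≤ roof C.carrier y from zero_le).eq_or_lt with hy | hy
    · rw [← hy, NNReal.zero_rpow h0.ne']; simp
    have := C.convex (log_roof_mem C.isCompact hx) (log_roof_mem C.isCompact hy)
      (sub_nonneg.2 h1.le) h0.le (by ring)
    have h2 := exp_le_roof C.isCompact this
    rw [← NNReal.coe_le_coe]
    refine le_trans (le_of_eq ?_) h2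
    have hx' : (0 : ℝ) < roof C.carrier x := by exact_mod_cast hx
    have hy' : (0 : ℝ) < roof C.carrier y := by exact_mod_cast hy
    push_cast
    rw [Real.rpow_def_of_pos hx', Real.rpow_def_of_pos hy', ← Real.exp_add]
    congr 1
    change Real.log _ * _ + _ = (1 - t) * _ + t * _
    ring
  upper_semicontinuous := by
    rw [upperSemicontinuous_iff_isClosed_preimage]
    intro r
    rcases (show 0 ≤ r from zero_le).eq_or_lt with rfl | hr
    · convert isClosed_univ
      ext; simp
    -- Superlevel sets at positive levels are projections of compact sets, because the supremum is
    -- attained.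
    have : roof C.carrier ⁻¹' Set.Ici r =
        Prod.fst '' (C.carrier ∩ Prod.snd ⁻¹' Set.Ici (Real.log r)) := by
      ext x
      simp only [Set.mem_preimage, Set.mem_Ici, Set.mem_image, Set.mem_inter_iff, Prod.exists,
        exists_and_right, exists_eq_right]
      constructor
      · intro h
        exact ⟨_, log_roof_mem C.isCompact (hr.trans_le h),
          Real.log_le_log (by exact_mod_cast hr) (by exact_mod_cast h)⟩
      · rintro ⟨t, h1, h2⟩
        rw [← NNReal.coe_le_coe]
        refine le_trans ?_ (exp_le_roof C.isCompact h1)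
        exact (Real.log_le_iff_le_exp (by exact_mod_cast hr)).1 h2
    rw [this]
    exact ((C.isCompact.inter_right (isClosed_Ici.preimage continuous_snd)).image
      continuous_fst).isClosed

theorem Body.exp_le (C : Body n) {x : E n} {t : ℝ} (h : (x, t) ∈ C.carrier) :
    Real.exp t ≤ C.toLC x := exp_le_roof C.isCompact h

theorem Body.pos (C : Body n) {x : E n} {t : ℝ} (h : (x, t) ∈ C.carrier) : 0 < C.toLC x := by
  exact_mod_cast (Real.exp_pos t).trans_le (C.exp_le h)

theorem Body.le_log (C : Body n) {x : E n} {t : ℝ} (h : (x, t) ∈ C.carrier) :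
    t ≤ Real.log (C.toLC x) :=
  (Real.le_log_iff_exp_le (by exact_mod_cast C.pos h)).2 (C.exp_le h)

theorem Body.log_mem (C : Body n) {x : E n} (h : 0 < C.toLC x) :
    (x, Real.log (C.toLC x)) ∈ C.carrier := log_roof_mem C.isCompact h

theorem Body.toLC_eq_of_forall_le (C : Body n) {x : E n} {t : ℝ} (h : (x, t) ∈ C.carrier)
    (hmax : ∀ s, (x, s) ∈ C.carrier → s ≤ t) : (C.toLC x : ℝ) = Real.exp t := by
  have := hmax _ (C.log_mem (C.pos h))
  refine le_antisymm ?_ (C.exp_le h)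
  rwa [Real.log_le_iff_le_exp (by exact_mod_cast C.pos h)] at this

theorem Body.toLC_eq_zero (C : Body n) {x : E n} (h : ∀ s, (x, s) ∉ C.carrier) :
    C.toLC x = 0 := by
  by_contra h0
  exact h _ (C.log_mem (pos_iff_ne_zero.2 h0))

/-! ### The perspective support function -/

/-- The support function `(y, s) ↦ sup {⟨x, y⟩ + s log f(x) : f(x) > 0}` of the hypograph
of `log f`. -/
def persp (f : LC n) (y : E n) (s : ℝ) : EReal :=
  ⨆ (x : E n) (_ : 0 < f x), ((inner ℝ x y + s * Real.log (f x) : ℝ) : EReal)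

theorem le_persp (f : LC n) {x : E n} (hx : 0 < f x) (y : E n) (s : ℝ) :
    ((inner ℝ x y + s * Real.log (f x) : ℝ) : EReal) ≤ persp f y s :=
  le_iSup₂ (f := fun (x : E n) (_ : 0 < f x) =>
    ((inner ℝ x y + s * Real.log (f x) : ℝ) : EReal)) x hx

theorem persp_le {f : LC n} {y : E n} {s : ℝ} {c : EReal}
    (h : ∀ x, 0 < f x → ((inner ℝ x y + s * Real.log (f x) : ℝ) : EReal) ≤ c) :
    persp f y s ≤ c := iSup₂_le h

theorem LC.exists_pos (f : LC n) : ∃ x, 0 < f x := by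
  obtain ⟨x, hx⟩ := f.exists_ne_zero
  exact ⟨x, pos_iff_ne_zero.2 hx⟩

theorem persp_ne_bot (f : LC n) (y : E n) (s : ℝ) : persp f y s ≠ ⊥ := by
  obtain ⟨x, hx⟩ := f.exists_pos
  exact ne_bot_of_le_ne_bot (EReal.coe_ne_bot _) (le_persp f hx y s)

theorem persp_mono {f g : LC n} (h : ∀ x, g x ≤ f x) (y : E n) {s : ℝ} (hs : 0 ≤ s) :
    persp g y s ≤ persp f y s := by
  refine persp_le fun x hx => le_trans ?_ (le_persp f (hx.trans_le (h x)) y s)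
  have : Real.log (g x) ≤ Real.log (f x) :=
    Real.log_le_log (by exact_mod_cast hx) (by exact_mod_cast h x)
  exact_mod_cast add_le_add_right (mul_le_mul_of_nonneg_left this hs) _

theorem supportFun_eq (f : LC n) (y : E n) : supportFun f y = persp f y 1 := by
  unfold supportFun legendre persp
  refine iSup_congr fun x => ?_
  rcases (show 0 ≤ f x from zero_le).eq_or_lt with hx | hx
  · simp [← hx]
  · have : ENNReal.log (f x : ℝ≥0∞) = (Real.log (f x) : EReal) := by
      rw [ENNReal.log_of_nnreal hx.ne']
    beta_reduce
    rw [this, iSup_pos hx, sub_eq_add_neg, neg_neg, one_mul]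
    norm_cast

/-- Closed half-spaces containing `{f > 0}` contain its closure, so taking the closure in `K_f` does
not affect the supremum. -/
theorem setSupportFun_eq (f : LC n) (θ : S n) :
    setSupportFun (suppSet f) θ = persp f (θ : E n) 0 := by
  unfold setSupportFun suppSet
  apply le_antisymm
  · refine iSup₂_le fun x hx => ?_
    have hcl : IsClosed {x : E n | ((inner ℝ x (θ : E n) : ℝ) : EReal) ≤ persp f (θ : E n) 0} :=
      isClosed_le (continuous_coe_real_ereal.comp (by fun_prop)) continuous_const
    refine closure_minimal (fun z hz => ?_) hcl hx
    simpa using le_persp f hz (θ : E n) 0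
  · refine persp_le fun x hx => ?_
    rw [zero_mul, add_zero]
    exact le_iSup₂ (f := fun (x : E n) (_ : x ∈ closure {x | 0 < f x}) =>
      ((inner ℝ x (θ : E n) : ℝ) : EReal)) x (subset_closure hx)

theorem persp_smul (f : LC n) {c : ℝ} (hc : 0 < c) (y : E n) (s : ℝ) :
    persp f (c • y) (c * s) = (c : EReal) * persp f y s := by
  have key : ∀ {c : ℝ}, 0 < c → ∀ (y : E n) (s : ℝ),
      persp f (c • y) (c * s) ≤ (c : EReal) * persp f y s := by
    intro c hc y s
    refine persp_le fun x hx => ?_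
    have h := mul_le_mul_of_nonneg_left (le_persp f hx y s)
      (show (0 : EReal) ≤ c by exact_mod_cast hc.le)
    refine le_trans (le_of_eq ?_) h
    rw [← EReal.coe_mul, inner_smul_right]
    ring_nf
  refine le_antisymm (key hc y s) ?_
  have h := mul_le_mul_of_nonneg_left (key (inv_pos.2 hc) (c • y) (c * s))
      (show (0 : EReal) ≤ c by exact_mod_cast hc.le)
  rwa [smul_smul, ← mul_assoc, inv_mul_cancel₀ hc.ne', one_smul, one_mul, ← mul_assoc,
    ← EReal.coe_mul, mul_inv_cancel₀ hc.ne', EReal.coe_one, one_mul] at h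

/-- The closed unit ball, as a compactification of `ℝⁿ` by the sphere. -/
abbrev Q (n : ℕ) : Type := Metric.closedBall (0 : E n) 1

theorem Q.norm_le (q : Q n) : ‖(q : E n)‖ ≤ 1 := mem_closedBall_zero_iff.1 q.2

theorem Q.nonneg (q : Q n) : 0 ≤ 1 - ‖(q : E n)‖ := sub_nonneg.2 q.norm_le

/-- The perspective support function on the ball `Q`, where `q` stands for `(q, 1 - ‖q‖)`. -/
def ballSupport (f : LC n) (q : Q n) : EReal := persp f (q : E n) (1 - ‖(q : E n)‖)

theorem measurable_ballSupport (f : LC n) : Measurable (ballSupport f) := by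
  apply LowerSemicontinuous.measurable
  unfold ballSupport persp
  refine lowerSemicontinuous_iSup fun x => lowerSemicontinuous_iSup fun _ => ?_
  apply Continuous.lowerSemicontinuous
  refine continuous_coe_real_ereal.comp ?_
  fun_prop

/-- One point with `f > 0` already gives a uniform bound, since `Q` is bounded. The bound keeps the
negative part integrable against every finite measure on `Q`. -/
theorem exists_forall_le_ballSupport (f : LC n) :
    ∃ c : ℝ, 0 ≤ c ∧ ∀ q, ((-c : ℝ) : EReal) ≤ ballSupport f q := by
  obtain ⟨x, hx⟩ := f.exists_pos
  refine ⟨‖x‖ + |Real.log (f x)|, by positivity, fun q => le_trans ?_ (le_persp f hx _ _)⟩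
  rw [EReal.coe_le_coe_iff]
  have h1 := abs_real_inner_le_norm x (q : E n)
  have h2 := q.norm_le
  have h3 := q.nonneg
  have h4 : ‖x‖ * ‖(q : E n)‖ ≤ ‖x‖ := mul_le_of_le_one_right (norm_nonneg _) h2
  have h5 : |(1 - ‖(q : E n)‖) * Real.log (f x)| ≤ |Real.log (f x)| := by
    rw [abs_mul, abs_of_nonneg h3]
    exact mul_le_of_le_one_left (abs_nonneg _) (by linarith [norm_nonneg (q : E n)])
  linarith [neg_abs_le (inner ℝ x (q : E n)),
    neg_abs_le ((1 - ‖(q : E n)‖) * Real.log (f x))]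

/-! ### Support functions and operations on compact convex sets -/

/-- The pairing of `(y, s)` with `z = (x, t)`. -/
def pair (y : E n) (s : ℝ) (z : E n × ℝ) : ℝ := inner ℝ z.1 y + s * z.2

theorem pair_add (y : E n) (s : ℝ) (z w : E n × ℝ) :
    pair y s (z + w) = pair y s z + pair y s w := by
  simp only [pair, Prod.fst_add, Prod.snd_add, inner_add_left]; ring

theorem pair_smul (y : E n) (s c : ℝ) (z : E n × ℝ) : pair y s (c • z) = c * pair y s z := by
  simp only [pair, Prod.smul_fst, Prod.smul_snd, real_inner_smul_left, smul_eq_mul]; ring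

theorem continuous_pair : Continuous fun p : Q n × (E n × ℝ) =>
    pair (p.1 : E n) (1 - ‖(p.1 : E n)‖) p.2 := by
  unfold pair; fun_prop

/-- The support function of `C` on the ball `Q`. -/
def Body.supp (C : Body n) : C(Q n, ℝ) where
  toFun q := sSup (pair (q : E n) (1 - ‖(q : E n)‖) '' C.carrier)
  continuous_toFun := C.isCompact.continuous_sSup
    (f := fun (q : Q n) z => pair (q : E n) (1 - ‖(q : E n)‖) z) continuous_pair

theorem Body.isGreatest_supp (C : Body n) (q : Q n) :
    IsGreatest (pair (q : E n) (1 - ‖(q : E n)‖) '' C.carrier) (C.supp q) := by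
  have hc : Continuous (pair (q : E n) (1 - ‖(q : E n)‖)) :=
    continuous_pair.comp (Continuous.prodMk_right q)
  exact (C.isCompact.image hc).isGreatest_sSup (C.nonempty.image _)

theorem Body.pair_le_supp (C : Body n) (q : Q n) {z : E n × ℝ} (hz : z ∈ C.carrier) :
    pair (q : E n) (1 - ‖(q : E n)‖) z ≤ C.supp q :=
  (C.isGreatest_supp q).2 ⟨z, hz, rfl⟩

theorem Body.supp_le (C : Body n) {q : Q n} {r : ℝ}
    (h : ∀ z ∈ C.carrier, pair (q : E n) (1 - ‖(q : E n)‖) z ≤ r) : C.supp q ≤ r := by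
  obtain ⟨z, hz, h'⟩ := (C.isGreatest_supp q).1
  exact h' ▸ h z hz

theorem Body.exists_supp_eq (C : Body n) (q : Q n) :
    ∃ z ∈ C.carrier, pair (q : E n) (1 - ‖(q : E n)‖) z = C.supp q := (C.isGreatest_supp q).1

theorem Body.ballSupport_toLC (C : Body n) (q : Q n) :
    ballSupport C.toLC q = (C.supp q : EReal) := by
  apply le_antisymm
  · exact persp_le fun x hx => EReal.coe_le_coe_iff.2 (C.pair_le_supp q (C.log_mem hx))
  · obtain ⟨z, hz, h⟩ := C.exists_supp_eq q
    rw [← h]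
    refine le_trans ?_ (le_persp C.toLC (C.pos (x := z.1) (t := z.2) hz) _ _)
    rw [EReal.coe_le_coe_iff]
    exact add_le_add_right (mul_le_mul_of_nonneg_left (C.le_log hz) q.nonneg) _

/-- A function whose support function is bounded by that of a compact convex set lies below it. -/
theorem Body.le_toLC_of_ballSupport_le (C : Body n) {g : LC n}
    (h : ∀ q, ballSupport g q ≤ C.supp q) (x : E n) : g x ≤ C.toLC x := by
  by_contra hlt
  push Not at hlt
  have hg : 0 < g x := (zero_le).trans_lt hlt
  have hg' : (0 : ℝ) < g x := by exact_mod_cast hg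
  -- If the inequality fails at `x`, the vertical ray above `(x, log g(x))` misses `C`. A hyperplane
  -- separating the two strictly yields a direction in which the support function of `g` exceeds
  -- that of `C`.
  have hdisj : Disjoint C.carrier ({x} ×ˢ Set.Ici (Real.log (g x))) := by
    rw [Set.disjoint_left]
    rintro ⟨a, t⟩ hz ⟨ha, ht⟩
    obtain rfl : a = x := ha
    have h1 := (Real.log_le_iff_le_exp hg').1 ht
    have h2 := h1.trans (C.exp_le hz)
    exact absurd hlt (not_lt.2 (by exact_mod_cast h2))
  obtain ⟨ℓ, u, v, h1, huv, h2⟩ := geometric_hahn_banach_compact_closed C.convex C.isCompact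
    ((convex_singleton x).prod (convex_Ici _)) (isClosed_singleton.prod isClosed_Ici) hdisj
  set y : E n := (InnerProductSpace.toDual ℝ (E n)).symm (ℓ.comp (ContinuousLinearMap.inl ℝ _ ℝ))
  set s : ℝ := ℓ (0, 1)
  have hℓ : ∀ z, ℓ z = pair y s z := by
    intro z
    have : z = (z.1, 0) + z.2 • ((0 : E n), (1 : ℝ)) := by ext <;> simp
    conv_lhs => rw [this]
    rw [map_add, map_smul, pair, real_inner_comm, InnerProductSpace.toDual_symm_apply,
      smul_eq_mul, mul_comm]
    rfl
  -- With `s < 0` the separating functional would be unbounded below on the upward ray. Hence only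
  -- directions with `s ≥ 0`, the ones seen by `Q`, are needed.
  have hs : 0 ≤ s := by
    by_contra hs
    push Not at hs
    have hmem := h2 (x, max (Real.log (g x)) ((v - inner ℝ x y) / s))
      ⟨rfl, Set.mem_Ici.2 (le_max_left _ _)⟩
    rw [hℓ, pair] at hmem
    have := mul_le_mul_of_nonpos_left (le_max_right (Real.log (g x)) ((v - inner ℝ x y) / s)) hs.le
    rw [mul_div_cancel₀ _ hs.ne] at this
    dsimp only at hmem
    linarith
  have hg2 := h2 (x, Real.log (g x)) ⟨rfl, Set.mem_Ici.2 le_rfl⟩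
  obtain ⟨z, hz⟩ := C.nonempty
  have hne : 0 < ‖y‖ + s := by
    by_contra hle
    have hy : y = 0 := by
      rw [← norm_eq_zero]; linarith [norm_nonneg y]
    have hs0 : s = 0 := by linarith [norm_nonneg y]
    have := h1 z hz
    rw [hℓ, hy, hs0] at this hg2
    simp [pair] at this hg2
    linarith
  have hq : ‖(‖y‖ + s)⁻¹ • y‖ = (‖y‖ + s)⁻¹ * ‖y‖ := by
    rw [norm_smul, Real.norm_eq_abs, abs_of_pos (inv_pos.2 hne)]
  have hq1 : 1 - ‖(‖y‖ + s)⁻¹ • y‖ = (‖y‖ + s)⁻¹ * s := by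
    rw [hq]; field_simp; ring
  -- Division by `‖y‖ + s` moves `(y, s)` along its ray to the form `(q, 1 - ‖q‖)`.
  let q : Q n := ⟨(‖y‖ + s)⁻¹ • y, by
    rw [mem_closedBall_zero_iff]
    have : 0 ≤ (‖y‖ + s)⁻¹ * s := by positivity
    linarith⟩
  have hpair : ∀ z, pair (q : E n) (1 - ‖(q : E n)‖) z = (‖y‖ + s)⁻¹ * ℓ z := by
    intro z
    change pair ((‖y‖ + s)⁻¹ • y) (1 - ‖(‖y‖ + s)⁻¹ • y‖) z = _
    rw [hq1, hℓ, pair, pair, inner_smul_right]; ring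
  have h3 : (pair (q : E n) (1 - ‖(q : E n)‖) (x, Real.log (g x)) : EReal) ≤ C.supp q :=
    (le_persp g hg (q : E n) (1 - ‖(q : E n)‖)).trans (h q)
  rw [EReal.coe_le_coe_iff, hpair] at h3
  obtain ⟨w, hw, hw'⟩ := C.exists_supp_eq q
  rw [← hw', hpair] at h3
  have := le_of_mul_le_mul_left h3 (inv_pos.2 hne)
  linarith [h1 w hw]

/-- The Minkowski combination `α C + β D`. -/
def Body.comb (α β : ℝ) (C D : Body n) : Body n where
  carrier := (fun p : (E n × ℝ) × (E n × ℝ) => α • p.1 + β • p.2) '' (C.carrier ×ˢ D.carrier)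
  convex := by
    refine (C.convex.prod D.convex).is_linear_image (f := fun p : (E n × ℝ) × (E n × ℝ) =>
      α • p.1 + β • p.2) ⟨fun p q => ?_, fun c p => ?_⟩
    · simp only [Prod.fst_add, Prod.snd_add, smul_add]; abel
    · simp only [Prod.smul_fst, Prod.smul_snd, smul_add, smul_comm c]
  isCompact := (C.isCompact.prod D.isCompact).image (by fun_prop)
  nonempty := (C.nonempty.prod D.nonempty).image _

theorem Body.mem_comb {α β : ℝ} {C D : Body n} {z : E n × ℝ} :
    z ∈ (Body.comb α β C D).carrier ↔ ∃ a ∈ C.carrier, ∃ b ∈ D.carrier, α • a + β • b = z :=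
  ⟨fun ⟨p, hp, h⟩ => ⟨p.1, hp.1, p.2, hp.2, h⟩,
    fun ⟨a, ha, b, hb, h⟩ => ⟨(a, b), ⟨ha, hb⟩, h⟩⟩

theorem Body.supp_comb {α β : ℝ} (hα : 0 ≤ α) (hβ : 0 ≤ β) (C D : Body n) (q : Q n) :
    (Body.comb α β C D).supp q = α * C.supp q + β * D.supp q := by
  apply le_antisymm
  · refine Body.supp_le _ fun z hz => ?_
    obtain ⟨a, ha, b, hb, rfl⟩ := Body.mem_comb.1 hz
    rw [pair_add, pair_smul, pair_smul]
    exact add_le_add (mul_le_mul_of_nonneg_left (C.pair_le_supp q ha) hα)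
      (mul_le_mul_of_nonneg_left (D.pair_le_supp q hb) hβ)
  · obtain ⟨a, ha, h1⟩ := C.exists_supp_eq q
    obtain ⟨b, hb, h2⟩ := D.exists_supp_eq q
    rw [← h1, ← h2, ← pair_smul, ← pair_smul, ← pair_add]
    exact Body.pair_le_supp _ q (Body.mem_comb.2 ⟨a, ha, b, hb, rfl⟩)

/-- The convex hull of the union of `C` and `D`. -/
def Body.hull (C D : Body n) : Body n where
  carrier := convexHull ℝ (C.carrier ∪ D.carrier)
  convex := convex_convexHull _ _
  isCompact := by
    rw [Convex.convexHull_union C.convex D.convex C.nonempty D.nonempty]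
    -- The hull of two convex sets is the union of segments between them, hence a continuous image
    -- of `[0, 1] × C × D`.
    have : convexJoin ℝ C.carrier D.carrier =
        (fun p : ℝ × (E n × ℝ) × (E n × ℝ) => (1 - p.1) • p.2.1 + p.1 • p.2.2) ''
          (Set.Icc 0 1 ×ˢ (C.carrier ×ˢ D.carrier)) := by
      ext z
      rw [mem_convexJoin]
      constructor
      · rintro ⟨a, ha, b, hb, hz⟩
        rw [segment_eq_image] at hz
        obtain ⟨t, ht, rfl⟩ := hz
        exact ⟨(t, a, b), ⟨ht, ha, hb⟩, rfl⟩
      · rintro ⟨⟨t, a, b⟩, ⟨ht, ha, hb⟩, rfl⟩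
        refine ⟨a, ha, b, hb, ?_⟩
        rw [segment_eq_image]
        exact ⟨t, ht, rfl⟩
    rw [this]
    exact (isCompact_Icc.prod (C.isCompact.prod D.isCompact)).image (by fun_prop)
  nonempty := (C.nonempty.mono Set.subset_union_left).convexHull

theorem Body.supp_hull (C D : Body n) (q : Q n) :
    (Body.hull C D).supp q = max (C.supp q) (D.supp q) := by
  apply le_antisymm
  · refine Body.supp_le _ fun z hz => ?_
    have hconv : Convex ℝ {z : E n × ℝ | pair (q : E n) (1 - ‖(q : E n)‖) z ≤
        max (C.supp q) (D.supp q)} :=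
      convex_halfSpace_le ⟨pair_add _ _, pair_smul _ _⟩ _
    refine convexHull_min ?_ hconv hz
    rintro w (hw | hw)
    · exact le_max_of_le_left (C.pair_le_supp q hw)
    · exact le_max_of_le_right (D.pair_le_supp q hw)
  · refine max_le (C.supp_le fun z hz => ?_) (D.supp_le fun z hz => ?_)
    · exact Body.pair_le_supp _ q (subset_convexHull _ _ (Or.inl hz))
    · exact Body.pair_le_supp _ q (subset_convexHull _ _ (Or.inr hz))

/-- A single point. -/
def Body.point (z : E n × ℝ) : Body n := ⟨{z}, convex_singleton z, isCompact_singleton, ⟨z, rfl⟩⟩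

/-- A ball in a horizontal hyperplane. -/
def Body.disc (x : E n) {r : ℝ} (hr : 0 ≤ r) (t : ℝ) : Body n where
  carrier := Metric.closedBall x r ×ˢ {t}
  convex := (convex_closedBall x r).prod (convex_singleton t)
  isCompact := (isCompact_closedBall x r).prod isCompact_singleton
  nonempty := ⟨(x, t), Metric.mem_closedBall_self hr, rfl⟩

/-- With `x = 0` and `t = r` the right-hand side is the constant `r`, and differences of such
expressions give all affine functions of `q`. -/
theorem Body.supp_disc (x : E n) {r : ℝ} (hr : 0 ≤ r) (t : ℝ) (q : Q n) :
    (Body.disc x hr t).supp q =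
      inner ℝ x (q : E n) + r * ‖(q : E n)‖ + (1 - ‖(q : E n)‖) * t := by
  apply le_antisymm
  · refine Body.supp_le _ fun z hz => ?_
    obtain ⟨h1, h2⟩ := hz
    rw [Set.mem_singleton_iff] at h2
    rw [pair, h2]
    have h3 : inner ℝ (z.1 - x) (q : E n) ≤ r * ‖(q : E n)‖ :=
      (real_inner_le_norm _ _).trans (mul_le_mul_of_nonneg_right (mem_closedBall_iff_norm.1 h1)
        (norm_nonneg _))
    rw [inner_sub_left] at h3
    linarith
  · rcases eq_or_ne (q : E n) 0 with h0 | h0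
    · have := (Body.disc x hr t).pair_le_supp q (z := (x, t)) ⟨Metric.mem_closedBall_self hr, rfl⟩
      simp only [pair, h0, inner_zero_right, norm_zero] at this ⊢
      linarith
    · have hn : ‖(q : E n)‖ ≠ 0 := norm_ne_zero_iff.2 h0
      -- The maximum over the ball is attained at the boundary point in direction `q`.
      have hmem : (x + (r * ‖(q : E n)‖⁻¹) • (q : E n), t) ∈ (Body.disc x hr t).carrier := by
        refine ⟨?_, rfl⟩
        rw [mem_closedBall_iff_norm, add_sub_cancel_left, norm_smul, Real.norm_eq_abs,
          abs_of_nonneg (by positivity), mul_assoc, inv_mul_cancel₀ hn, mul_one]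
      have := (Body.disc x hr t).pair_le_supp q hmem
      refine le_trans (le_of_eq ?_) this
      rw [pair]
      simp only [inner_add_left, real_inner_smul_left, real_inner_self_eq_norm_sq]
      field_simp

theorem Body.toLC_eq_of_supp_eq {C D : Body n} (h : ∀ q, C.supp q = D.supp q) :
    C.toLC = D.toLC := by
  have key : ∀ C D : Body n, (∀ q, C.supp q = D.supp q) → ∀ x, C.toLC x ≤ D.toLC x :=
    fun C D h x => D.le_toLC_of_ballSupport_le (fun q => by rw [C.ballSupport_toLC, h]) x
  have : C.toLC.toFun = D.toLC.toFun :=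
    funext fun x => le_antisymm (key C D h x) (key D C (fun q => (h q).symm) x)
  cases hC : C.toLC; cases hD : D.toLC
  simp_all

theorem Body.toLC_mono {C D : Body n} (h : ∀ q, C.supp q ≤ D.supp q) (x : E n) :
    C.toLC x ≤ D.toLC x :=
  D.le_toLC_of_ballSupport_le
    (fun q => by rw [C.ballSupport_toLC]; exact_mod_cast h q) x

/-! ### Sup-convolution -/

theorem dilate_pos_iff {α : ℝ} (hα : 0 < α) {f : E n → ℝ≥0} {x : E n} :
    0 < dilate α f x ↔ 0 < f (α⁻¹ • x) := by
  constructor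
  · intro h
    by_contra h0
    have : f (α⁻¹ • x) = 0 := le_antisymm (not_lt.1 h0) zero_le
    rw [dilate, this, NNReal.zero_rpow hα.ne'] at h
    exact lt_irrefl _ h
  · exact fun h => NNReal.rpow_pos h

theorem log_dilate {α : ℝ} {f : E n → ℝ≥0} {x : E n} (h : 0 < f (α⁻¹ • x)) :
    Real.log (dilate α f x) = α * Real.log (f (α⁻¹ • x)) := by
  rw [dilate, NNReal.coe_rpow, Real.log_rpow (by exact_mod_cast h)]

theorem log_dilate_mul_dilate {α β : ℝ} {f g : E n → ℝ≥0} {x y : E n} (hf : 0 < f (α⁻¹ • x))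
    (hg : 0 < g (β⁻¹ • y)) : Real.log ((dilate α f x * dilate β g y : ℝ≥0) : ℝ) =
      α * Real.log (f (α⁻¹ • x)) + β * Real.log (g (β⁻¹ • y)) := by
  have h1 : (0 : ℝ) < dilate α f x := by exact_mod_cast NNReal.rpow_pos hf
  have h2 : (0 : ℝ) < dilate β g y := by exact_mod_cast NNReal.rpow_pos hg
  rw [NNReal.coe_mul, Real.log_mul h1.ne' h2.ne', log_dilate hf, log_dilate hg]

theorem supConv_le_iff {α β : ℝ} (hα : 0 < α) (hβ : 0 < β) {f g : E n → ℝ≥0} {x : E n} {c : ℝ≥0∞} :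
    supConv (dilate α f) (dilate β g) x ≤ c ↔
      ∀ y, 0 < f (α⁻¹ • y) → 0 < g (β⁻¹ • (x - y)) →
        ((dilate α f y * dilate β g (x - y) : ℝ≥0) : ℝ≥0∞) ≤ c := by
  unfold supConv
  rw [iSup_le_iff]
  refine ⟨fun h y _ _ => h y, fun h y => ?_⟩
  by_cases hf : 0 < f (α⁻¹ • y)
  · by_cases hg : 0 < g (β⁻¹ • (x - y))
    · exact h y hf hg
    · have : dilate β g (x - y) = 0 :=
        le_antisymm (not_lt.1 fun h => hg ((dilate_pos_iff hβ).1 h)) zero_le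
      simp [this]
  · have : dilate α f y = 0 :=
      le_antisymm (not_lt.1 fun h => hf ((dilate_pos_iff hα).1 h)) zero_le
    simp [this]

theorem le_supConv {α β : ℝ} (hα : 0 < α) (hβ : 0 < β) (f g : E n → ℝ≥0) (a b : E n) :
    ((f a ^ α * g b ^ β : ℝ≥0) : ℝ≥0∞) ≤
      supConv (dilate α f) (dilate β g) (α • a + β • b) := by
  refine le_trans (le_of_eq ?_) (le_iSup (fun y => ((dilate α f y *
    dilate β g (α • a + β • b - y) : ℝ≥0) : ℝ≥0∞)) (α • a))
  simp only [dilate, add_sub_cancel_left, smul_smul, inv_mul_cancel₀ hα.ne',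
    inv_mul_cancel₀ hβ.ne', one_smul]

/-- Each point of the Minkowski combination splits into points of the two bodies, and the
combination is again compact. No upper semicontinuous hull is needed, so plain sup-linearity of `F`
applies to bodies. -/
theorem Body.toLC_comb {α β : ℝ} (hα : 0 < α) (hβ : 0 < β) (C D : Body n) (x : E n) :
    ((Body.comb α β C D).toLC x : ℝ≥0∞) = supConv (dilate α C.toLC) (dilate β D.toLC) x := by
  apply le_antisymm
  · rcases (show 0 ≤ (Body.comb α β C D).toLC x from zero_le).eq_or_lt with h | h
    · simp [← h]
    · obtain ⟨a, ha, b, hb, hab⟩ := Body.mem_comb.1 (Body.log_mem _ h)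
      have h1 : α • a.1 + β • b.1 = x := congrArg Prod.fst hab
      have h2 : α * a.2 + β * b.2 = Real.log ((Body.comb α β C D).toLC x) :=
        congrArg Prod.snd hab
      have hle := le_supConv hα hβ C.toLC D.toLC a.1 b.1
      rw [h1] at hle
      refine le_trans ?_ hle
      rw [ENNReal.coe_le_coe, ← NNReal.coe_le_coe,
        ← Real.exp_log (show (0 : ℝ) < (Body.comb α β C D).toLC x by exact_mod_cast h), ← h2,
        Real.exp_add, mul_comm α, mul_comm β, Real.exp_mul, Real.exp_mul]
      push_cast
      exact mul_le_mul (Real.rpow_le_rpow (Real.exp_pos _).le (C.exp_le ha) hα.le)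
        (Real.rpow_le_rpow (Real.exp_pos _).le (D.exp_le hb) hβ.le) (by positivity) (by positivity)
  · refine (supConv_le_iff hα hβ).2 fun y hf hg => ?_
    have hmem : (x, α * Real.log (C.toLC (α⁻¹ • y)) + β * Real.log (D.toLC (β⁻¹ • (x - y)))) ∈
        (Body.comb α β C D).carrier := by
      refine Body.mem_comb.2 ⟨_, C.log_mem hf, _, D.log_mem hg, ?_⟩
      simp only [Prod.smul_mk, Prod.mk_add_mk, smul_smul, mul_inv_cancel₀ hα.ne',
        mul_inv_cancel₀ hβ.ne', one_smul, add_sub_cancel, smul_eq_mul]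
    have h := Body.exp_le _ hmem
    rw [← log_dilate_mul_dilate hf hg, Real.exp_log] at h
    · exact_mod_cast h
    · exact_mod_cast mul_pos ((dilate_pos_iff hα).2 hf) ((dilate_pos_iff hβ).2 hg)

/-- The two hypotheses on `h` say that it majorizes the sup-convolution and lies below every upper
semicontinuous majorant. The support function does not see the passage to the hull, because each
bound on it is itself an upper semicontinuous majorant. -/
theorem persp_sup_linear {f g h : LC n} {α β : ℝ} (hα : 0 < α) (hβ : 0 < β)
    (hle : ∀ x, supConv (dilate α f) (dilate β g) x ≤ h x)
    (hmin : ∀ v : E n → ℝ≥0∞, UpperSemicontinuous v →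
      (∀ x, supConv (dilate α f) (dilate β g) x ≤ v x) → ∀ x, h x ≤ v x)
    (y : E n) {s : ℝ} (hs : 0 ≤ s) :
    persp h y s = (α : EReal) * persp f y s + (β : EReal) * persp g y s := by
  apply le_antisymm
  · by_cases htop : persp f y s = ⊤ ∨ persp g y s = ⊤
    · have hbot : ∀ {γ : ℝ}, 0 < γ → ∀ k : LC n, (γ : EReal) * persp k y s ≠ ⊥ := by
        intro γ hγ k
        rw [← persp_smul k hγ]; exact persp_ne_bot _ _ _
      rcases htop with h1 | h1
      · rw [h1, EReal.coe_mul_top_of_pos hα, EReal.top_add_of_ne_bot (hbot hβ g)]; exact le_top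
      · rw [h1, EReal.coe_mul_top_of_pos hβ, EReal.add_top_of_ne_bot (hbot hα f)]; exact le_top
    push Not at htop
    lift persp f y s to ℝ using ⟨htop.1, persp_ne_bot _ _ _⟩ with p hp
    lift persp g y s to ℝ using ⟨htop.2, persp_ne_bot _ _ _⟩ with q hq
    rw [← EReal.coe_mul, ← EReal.coe_mul, ← EReal.coe_add]
    have hf : ∀ a, 0 < f a → inner ℝ a y + s * Real.log (f a) ≤ p := fun a ha => by
      have := le_persp f ha y s
      rw [← hp] at this; exact_mod_cast this
    have hg : ∀ b, 0 < g b → inner ℝ b y + s * Real.log (g b) ≤ q := fun b hb => by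
      have := le_persp g hb y s
      rw [← hq] at this; exact_mod_cast this
    have key : ∀ x z, 0 < f (α⁻¹ • z) → 0 < g (β⁻¹ • (x - z)) →
        inner ℝ x y + s * Real.log ((dilate α f z * dilate β g (x - z) : ℝ≥0) : ℝ) ≤
          α * p + β * q := by
      intro x z h1 h2
      rw [log_dilate_mul_dilate h1 h2]
      have h3 := mul_le_mul_of_nonneg_left (hf _ h1) hα.le
      have h4 := mul_le_mul_of_nonneg_left (hg _ h2) hβ.le
      rw [real_inner_smul_left, mul_add, ← mul_assoc, mul_inv_cancel₀ hα.ne'] at h3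
      rw [real_inner_smul_left, mul_add, ← mul_assoc, mul_inv_cancel₀ hβ.ne', inner_sub_left] at h4
      linarith
    rcases hs.eq_or_lt with rfl | hs
    · refine persp_le fun x hx => EReal.coe_le_coe_iff.2 ?_
      -- For `s = 0` the bound concerns only the support, so the majorant is `⊤` on a closed
      -- half-space and `0` elsewhere.
      have hcl : IsClosed {x : E n | inner ℝ x y ≤ α * p + β * q} :=
        isClosed_le (by fun_prop) continuous_const
      have := hmin _ (hcl.upperSemicontinuous_indicator (y := (⊤ : ℝ≥0∞)) zero_le)
        (fun x => (supConv_le_iff hα hβ).2 fun z h1 h2 => ?_) x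
      · by_contra hlt
        rw [zero_mul, add_zero] at hlt
        rw [Set.indicator_of_notMem (show x ∉ {x : E n | inner ℝ x y ≤ α * p + β * q} from hlt)]
          at this
        exact absurd this (by simpa using hx.ne')
      · have h3 := key x z h1 h2
        rw [zero_mul, add_zero] at h3
        rw [Set.indicator_of_mem (show x ∈ {x : E n | inner ℝ x y ≤ α * p + β * q} from h3)]
        exact le_top
    · refine persp_le fun x hx => EReal.coe_le_coe_iff.2 ?_
      -- For `s > 0` the bound `⟨x, y⟩ + s log h(x) ≤ α p + β q`, solved for `h(x)`, gives a
      -- continuous majorant.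
      have hcont : Continuous fun x : E n =>
          ENNReal.ofReal (Real.exp ((α * p + β * q - inner ℝ x y) / s)) :=
        ENNReal.continuous_ofReal.comp (by fun_prop)
      have := hmin _ hcont.upperSemicontinuous
        (fun x => (supConv_le_iff hα hβ).2 fun z h1 h2 => ?_) x
      · rw [← ENNReal.ofReal_coe_nnreal, ENNReal.ofReal_le_ofReal_iff (Real.exp_pos _).le,
          ← Real.log_le_iff_le_exp (by exact_mod_cast hx), le_div_iff₀ hs] at this
        linarith
      · rw [← ENNReal.ofReal_coe_nnreal, ENNReal.ofReal_le_ofReal_iff (Real.exp_pos _).le,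
          ← Real.log_le_iff_le_exp, le_div_iff₀ hs]
        · linarith [key x z h1 h2]
        · exact_mod_cast mul_pos ((dilate_pos_iff hα).2 h1) ((dilate_pos_iff hβ).2 h2)
  · rw [← persp_smul f hα, ← persp_smul g hβ]
    refine EReal.add_le_of_forall_lt fun a' ha' b' hb' => ?_
    unfold persp at ha' hb'
    simp only [lt_iSup_iff] at ha' hb'
    obtain ⟨a, ha, ha'⟩ := ha'
    obtain ⟨b, hb, hb'⟩ := hb'
    have h1 : f a ^ α * g b ^ β ≤ h (α • a + β • b) := by
      exact_mod_cast (le_supConv hα hβ f g a b).trans (hle _)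
    have hpos : 0 < f a ^ α * g b ^ β := mul_pos (NNReal.rpow_pos ha) (NNReal.rpow_pos hb)
    refine (add_le_add ha'.le hb'.le).trans (le_trans ?_ (le_persp h (hpos.trans_le h1) y s))
    rw [← EReal.coe_add, EReal.coe_le_coe_iff]
    have h2 : Real.log ((f a ^ α * g b ^ β : ℝ≥0) : ℝ) ≤ Real.log (h (α • a + β • b)) :=
      Real.log_le_log (by exact_mod_cast hpos) (by exact_mod_cast h1)
    have ha0 : (0 : ℝ) < f a := by exact_mod_cast ha
    have hb0 : (0 : ℝ) < g b := by exact_mod_cast hb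
    rw [NNReal.coe_mul, NNReal.coe_rpow, NNReal.coe_rpow, Real.log_mul (by positivity)
      (by positivity), Real.log_rpow ha0, Real.log_rpow hb0] at h2
    have h3 := mul_le_mul_of_nonneg_left h2 hs
    rw [inner_add_left, real_inner_smul_left, real_inner_smul_left, inner_smul_right,
      inner_smul_right]
    linarith

theorem le_uscHull (u : E n → ℝ≥0∞) (x : E n) : u x ≤ uscHull u x := by
  refine le_limsup_of_frequently_le ?_
  rw [frequently_iff]
  exact fun hU => ⟨x, mem_of_mem_nhds hU, le_rfl⟩

theorem uscHull_le {u v : E n → ℝ≥0∞} (hv : UpperSemicontinuous v) (h : ∀ x, u x ≤ v x)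
    (x : E n) : uscHull u x ≤ v x :=
  (limsup_le_limsup (Eventually.of_forall h)).trans (UpperSemicontinuous.limsup_le hv x)

theorem uscHull_eq_of_coe_eq {u : E n → ℝ≥0∞} {h : LC n} (hu : ∀ x, (h x : ℝ≥0∞) = u x)
    (x : E n) : (h x : ℝ≥0∞) = uscHull u x := by
  rw [hu]
  refine le_antisymm (le_uscHull u x) (uscHull_le ?_ (fun _ => le_rfl) x)
  have : u = fun x => (h x : ℝ≥0∞) := funext fun x => (hu x).symm
  rw [this]
  exact ENNReal.continuous_coe.comp_upperSemicontinuous h.upper_semicontinuous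
    ENNReal.coe_mono

theorem IsClosedSupLinear.isSupLinear {F : LC n → EReal} (hF : IsClosedSupLinear F) :
    IsSupLinear F :=
  fun f g h α β hα hβ hh => hF f g h α β hα hβ (uscHull_eq_of_coe_eq hh)

theorem persp_eq_of_uscHull {f g h : LC n} {α β : ℝ} (hα : 0 < α) (hβ : 0 < β)
    (hh : ∀ x, (h x : ℝ≥0∞) = uscHull (supConv (dilate α f) (dilate β g)) x)
    (y : E n) {s : ℝ} (hs : 0 ≤ s) :
    persp h y s = (α : EReal) * persp f y s + (β : EReal) * persp g y s :=
  persp_sup_linear hα hβ (fun x => hh x ▸ le_uscHull _ x)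
    (fun _ hv hle x => hh x ▸ uscHull_le hv hle x) y hs

theorem monotone_persp {u : ℕ → LC n} (hu : ∀ x, Monotone fun i => u i x) (y : E n) {s : ℝ}
    (hs : 0 ≤ s) : Monotone fun i => persp (u i) y s :=
  fun _ _ hij => persp_mono (fun x => hu x hij) y hs

theorem persp_eq_iSup {u : ℕ → LC n} {f : LC n} (hu : ∀ x, Monotone fun i => u i x)
    (hf : ∀ x, Tendsto (fun i => u i x) atTop (𝓝 (f x))) (y : E n) {s : ℝ} (hs : 0 ≤ s) :
    persp f y s = ⨆ i, persp (u i) y s := by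
  apply le_antisymm
  · refine persp_le fun x hx => ?_
    have hx' : (0 : ℝ) < f x := by exact_mod_cast hx
    have hlim : Tendsto (fun i => ((inner ℝ x y + s * Real.log (u i x) : ℝ) : EReal)) atTop
        (𝓝 ((inner ℝ x y + s * Real.log (f x) : ℝ) : EReal)) := by
      refine (continuous_coe_real_ereal.tendsto _).comp ?_
      refine tendsto_const_nhds.add (Tendsto.const_mul s ?_)
      exact (Real.continuousAt_log hx'.ne').tendsto.comp (NNReal.tendsto_coe.2 (hf x))
    refine le_of_tendsto hlim ?_
    -- A point with `f x > 0` eventually enters the sets `{u i > 0}`. This is what makes the case `s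
    -- = 0` pass to the limit too.
    filter_upwards [(hf x).eventually (lt_mem_nhds hx)] with i hi
    exact (le_persp (u i) hi y s).trans (le_iSup (fun i => persp (u i) y s) i)
  · exact iSup_le fun i => persp_mono (fun x => (hu x).ge_of_tendsto (hf x) i) y hs

/-! ### Integrals of extended-real functions bounded below -/

section Eintegral

variable {X : Type*} [MeasurableSpace X] {M : Measure X}

theorem toENNReal_neg_le {x : EReal} {c : ℝ} (h : ((-c : ℝ) : EReal) ≤ x) :
    (-x).toENNReal ≤ ENNReal.ofReal c := by
  rw [← EReal.real_coe_toENNReal]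
  exact EReal.toENNReal_le_toENNReal (EReal.neg_le_of_neg_le h)

theorem toENNReal_add_ofReal {x : EReal} {c : ℝ} (hc : 0 ≤ c) (h : ((-c : ℝ) : EReal) ≤ x) :
    x.toENNReal + ENNReal.ofReal c = (-x).toENNReal + (x + c).toENNReal := by
  induction x with
  | bot => simp at h
  | top => simp
  | coe x =>
    rw [EReal.coe_le_coe_iff] at h
    rw [← EReal.coe_neg, ← EReal.coe_add]
    simp only [EReal.real_coe_toENNReal]
    rcases le_total 0 x with hx | hx
    · rw [ENNReal.ofReal_of_nonpos (neg_nonpos.2 hx), zero_add, ENNReal.ofReal_add hx hc]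
    · rw [ENNReal.ofReal_of_nonpos hx, zero_add, ← ENNReal.ofReal_add (by linarith) (by linarith)]
      ring_nf

theorem lintegral_neg_ne_top [IsFiniteMeasure M] {φ : X → EReal} {c : ℝ}
    (h : ∀ x, ((-c : ℝ) : EReal) ≤ φ x) : ∫⁻ x, (-φ x).toENNReal ∂M ≠ ⊤ := by
  refine ne_top_of_le_ne_top ?_ (lintegral_mono fun x => toENNReal_neg_le (h x))
  rw [lintegral_const]
  exact ENNReal.mul_ne_top ENNReal.ofReal_ne_top (measure_ne_top _ _)

/-- Integrating `x⁺ + c = x⁻ + (x + c)`, valid for `x ≥ -c`, and using that the integral of `x⁻` is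
finite. Linearity and monotone convergence thereby reduce to integrals of nonnegative functions. -/
theorem eintegral_eq_sub [IsFiniteMeasure M] {φ : X → EReal} (hφ : Measurable φ) {c : ℝ}
    (hc : 0 ≤ c) (h : ∀ x, ((-c : ℝ) : EReal) ≤ φ x) :
    eintegral M φ = ((∫⁻ x, (φ x + c).toENNReal ∂M : ℝ≥0∞) : EReal) -
      ((c * M.real Set.univ : ℝ) : EReal) := by
  have hsum : ∫⁻ x, (φ x).toENNReal ∂M + ENNReal.ofReal (c * M.real Set.univ) =
      ∫⁻ x, (-φ x).toENNReal ∂M + ∫⁻ x, (φ x + c).toENNReal ∂M := by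
    have h1 : ENNReal.ofReal (c * M.real Set.univ) = ∫⁻ _, ENNReal.ofReal c ∂M := by
      rw [lintegral_const, ENNReal.ofReal_mul hc, ofReal_measureReal]
    rw [h1, ← lintegral_add_left hφ.ereal_toENNReal,
      ← lintegral_add_left (f := fun x => (-φ x).toENNReal) hφ.neg.ereal_toENNReal]
    exact lintegral_congr fun x => toENNReal_add_ofReal hc (h x)
  have hneg := lintegral_neg_ne_top (M := M) h
  unfold eintegral
  generalize ∫⁻ x, (φ x).toENNReal ∂M = a at *
  generalize ∫⁻ x, (-φ x).toENNReal ∂M = b at *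
  generalize ∫⁻ x, (φ x + c).toENNReal ∂M = d at *
  have hk : 0 ≤ c * M.real Set.univ := by positivity
  generalize c * M.real Set.univ = k at *
  lift b to ℝ≥0 using hneg
  induction d using ENNReal.recTopCoe with
  | top =>
    have : a = ⊤ := by
      rw [add_top, ENNReal.add_eq_top] at hsum
      exact hsum.resolve_right ENNReal.ofReal_ne_top
    subst this
    rw [EReal.coe_ennreal_top, EReal.top_sub_coe]
    exact EReal.top_sub_coe (b : ℝ)
  | coe d =>
    have : a ≠ ⊤ := by
      rintro rfl
      rw [top_add, ← ENNReal.coe_add] at hsum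
      exact ENNReal.coe_ne_top hsum.symm
    lift a to ℝ≥0 using this
    have h2 : (a : ℝ) + k = b + d := by
      have := congrArg ENNReal.toReal hsum
      rwa [ENNReal.toReal_add ENNReal.coe_ne_top ENNReal.ofReal_ne_top,
        ENNReal.toReal_add ENNReal.coe_ne_top ENNReal.coe_ne_top, ENNReal.toReal_ofReal hk] at this
    change (((a : ℝ) : EReal) - ((b : ℝ) : EReal)) = ((d : ℝ) : EReal) - (k : EReal)
    rw [← EReal.coe_sub, ← EReal.coe_sub]
    congr 1
    linarith

theorem eintegral_ne_bot [IsFiniteMeasure M] {φ : X → EReal} {c : ℝ}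
    (h : ∀ x, ((-c : ℝ) : EReal) ≤ φ x) : eintegral M φ ≠ ⊥ := by
  have h1 := lintegral_neg_ne_top (M := M) h
  unfold eintegral
  generalize ∫⁻ x, (-φ x).toENNReal ∂M = b at *
  lift b to ℝ≥0 using h1
  rw [sub_eq_add_neg]
  refine EReal.add_ne_bot_iff.2 ⟨EReal.coe_ennreal_ne_bot _, ?_⟩
  change -((b : ℝ) : EReal) ≠ ⊥
  rw [← EReal.coe_neg]
  exact EReal.coe_ne_bot _

theorem eintegral_mono {φ ψ : X → EReal} (h : ∀ x, φ x ≤ ψ x) :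
    eintegral M φ ≤ eintegral M ψ := by
  refine EReal.sub_le_sub ?_ ?_
  · exact EReal.coe_ennreal_le_coe_ennreal_iff.2
      (lintegral_mono fun x => EReal.toENNReal_le_toENNReal (h x))
  · exact EReal.coe_ennreal_le_coe_ennreal_iff.2
      (lintegral_mono fun x => EReal.toENNReal_le_toENNReal (EReal.neg_le_neg_iff.2 (h x)))

theorem tendsto_eintegral_of_monotone [IsFiniteMeasure M] {φ : ℕ → X → EReal} {ψ : X → EReal}
    (hm : ∀ i, Measurable (φ i)) (hmono : ∀ x, Monotone fun i => φ i x)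
    (hsup : ∀ x, ψ x = ⨆ i, φ i x) {c : ℝ} (hc : 0 ≤ c)
    (h : ∀ x, ((-c : ℝ) : EReal) ≤ φ 0 x) :
    Tendsto (fun i => eintegral M (φ i)) atTop (𝓝 (eintegral M ψ)) := by
  have hψ : Measurable ψ := by
    rw [show ψ = fun x => ⨆ i, φ i x from funext hsup]
    exact Measurable.iSup hm
  have hlow : ∀ i x, ((-c : ℝ) : EReal) ≤ φ i x := fun i x => (h x).trans (hmono x (Nat.zero_le i))
  have hlowψ : ∀ x, ((-c : ℝ) : EReal) ≤ ψ x := fun x => by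
    rw [hsup]; exact (h x).trans (le_iSup (fun i => φ i x) 0)
  rw [eintegral_eq_sub hψ hc hlowψ]
  simp_rw [fun i => eintegral_eq_sub (M := M) (hm i) hc (hlow i)]
  have hlim : Tendsto (fun i => ∫⁻ x, (φ i x + c).toENNReal ∂M) atTop
      (𝓝 (∫⁻ x, (ψ x + c).toENNReal ∂M)) := by
    refine lintegral_tendsto_of_tendsto_of_monotone
      (fun i => ((hm i).add_const _).ereal_toENNReal.aemeasurable)
      (Eventually.of_forall fun x i j hij => EReal.toENNReal_le_toENNReal
        (add_le_add_left (hmono x hij) _)) (Eventually.of_forall fun x => ?_)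
    refine (EReal.continuous_toENNReal.tendsto _).comp ?_
    have h1 : Tendsto (fun i => φ i x) atTop (𝓝 (ψ x)) := by
      rw [hsup]; exact tendsto_atTop_iSup (hmono x)
    exact (EReal.continuousAt_add (p := (ψ x, (c : EReal))) (Or.inr (EReal.coe_ne_bot _))
      (Or.inr (EReal.coe_ne_top _))).tendsto.comp (h1.prodMk_nhds tendsto_const_nhds)
  have h2 := (continuous_coe_ennreal_ereal.tendsto _).comp hlim
  simp_rw [sub_eq_add_neg, ← EReal.coe_neg]
  exact (EReal.continuousAt_add (p := (((∫⁻ x, (ψ x + c).toENNReal ∂M : ℝ≥0∞) : EReal),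
      ((-(c * M.real Set.univ) : ℝ) : EReal))) (Or.inr (EReal.coe_ne_bot _))
      (Or.inr (EReal.coe_ne_top _))).tendsto.comp (h2.prodMk_nhds tendsto_const_nhds)

theorem mul_coe_sub_add (a b : ℝ≥0∞) {α β k l : ℝ} (hα : 0 < α) (hβ : 0 < β) :
    ((ENNReal.ofReal α * a + ENNReal.ofReal β * b : ℝ≥0∞) : EReal) -
      ((α * k + β * l : ℝ) : EReal) =
      (α : EReal) * ((a : EReal) - (k : EReal)) + (β : EReal) * ((b : EReal) - (l : EReal)) := by
  have htop : ∀ {α : ℝ}, 0 < α → ENNReal.ofReal α * ⊤ = ⊤ := fun h =>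
    ENNReal.mul_top (by simpa using h)
  have hreal : ∀ {β : ℝ}, 0 < β → ∀ (b : ℝ≥0) (l : ℝ),
      (β : EReal) * (((b : ℝ≥0∞) : EReal) - (l : EReal)) = ((β * (b - l) : ℝ) : EReal) := by
    intro β _ b l
    rw [EReal.coe_mul, EReal.coe_sub]; rfl
  have hbot : ∀ {β : ℝ}, 0 < β → ∀ (b : ℝ≥0∞) (l : ℝ),
      (β : EReal) * ((b : EReal) - (l : EReal)) ≠ ⊥ := by
    intro β hβ b l
    induction b using ENNReal.recTopCoe with
    | top =>
      rw [EReal.coe_ennreal_top, EReal.top_sub_coe, EReal.coe_mul_top_of_pos hβ]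
      exact top_ne_bot
    | coe b => rw [hreal hβ]; exact EReal.coe_ne_bot _
  induction a using ENNReal.recTopCoe with
  | top =>
    rw [htop hα, top_add, EReal.coe_ennreal_top, EReal.top_sub_coe, EReal.top_sub_coe,
      EReal.coe_mul_top_of_pos hα, EReal.top_add_of_ne_bot (hbot hβ b l)]
  | coe a =>
    induction b using ENNReal.recTopCoe with
    | top =>
      rw [htop hβ, add_top, EReal.coe_ennreal_top, EReal.top_sub_coe, EReal.top_sub_coe,
        EReal.coe_mul_top_of_pos hβ, EReal.add_top_of_ne_bot (hbot hα a k)]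
    | coe b =>
      rw [hreal hα, hreal hβ, ← EReal.coe_add, ENNReal.ofReal, ENNReal.ofReal, ← ENNReal.coe_mul,
        ← ENNReal.coe_mul, ← ENNReal.coe_add]
      change (((α.toNNReal * a + β.toNNReal * b : ℝ≥0) : ℝ) : EReal) - _ = _
      rw [← EReal.coe_sub]
      congr 1
      push_cast [Real.coe_toNNReal _ hα.le, Real.coe_toNNReal _ hβ.le]
      ring

theorem toENNReal_comb_add {x y : EReal} {α β c d : ℝ} (hα : 0 < α) (hβ : 0 < β)
    (hx : ((-c : ℝ) : EReal) ≤ x) (hy : ((-d : ℝ) : EReal) ≤ y) :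
    ((α : EReal) * x + (β : EReal) * y + ((α * c + β * d : ℝ) : EReal)).toENNReal =
      ENNReal.ofReal α * (x + c).toENNReal + ENNReal.ofReal β * (y + d).toENNReal := by
  have hnn : ∀ {x : EReal} {c : ℝ}, ((-c : ℝ) : EReal) ≤ x → 0 ≤ x + c := by
    intro x c h
    have := add_le_add_left h (c : EReal)
    rwa [← EReal.coe_add, neg_add_cancel, EReal.coe_zero] at this
  have hα' : (0 : EReal) ≤ α := by exact_mod_cast hα.le
  have hβ' : (0 : EReal) ≤ β := by exact_mod_cast hβ.le
  rw [← EReal.real_coe_toENNReal α, ← EReal.real_coe_toENNReal β, ← EReal.toENNReal_mul hα',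
    ← EReal.toENNReal_mul hβ', ← EReal.toENNReal_add (mul_nonneg hα' (hnn hx))
    (mul_nonneg hβ' (hnn hy))]
  congr 1
  rw [EReal.left_distrib_of_nonneg_of_ne_top hα' (EReal.coe_ne_top _),
    EReal.left_distrib_of_nonneg_of_ne_top hβ' (EReal.coe_ne_top _), EReal.coe_add, EReal.coe_mul,
    EReal.coe_mul, add_add_add_comm]

theorem eintegral_comb [IsFiniteMeasure M] {φ ψ : X → EReal} (hφ : Measurable φ)
    (hψ : Measurable ψ) {c d : ℝ} (hc : 0 ≤ c) (hd : 0 ≤ d)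
    (hcφ : ∀ x, ((-c : ℝ) : EReal) ≤ φ x) (hdψ : ∀ x, ((-d : ℝ) : EReal) ≤ ψ x)
    {χ : X → EReal} (hχ : Measurable χ) {α β : ℝ} (hα : 0 < α) (hβ : 0 < β)
    (h : ∀ x, χ x = (α : EReal) * φ x + (β : EReal) * ψ x) :
    eintegral M χ = (α : EReal) * eintegral M φ + (β : EReal) * eintegral M ψ := by
  have hlow : ∀ x, ((-(α * c + β * d) : ℝ) : EReal) ≤ χ x := by
    intro x
    rw [h]
    have h1 := mul_le_mul_of_nonneg_left (hcφ x) (show (0 : EReal) ≤ α by exact_mod_cast hα.le)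
    have h2 := mul_le_mul_of_nonneg_left (hdψ x) (show (0 : EReal) ≤ β by exact_mod_cast hβ.le)
    refine le_trans (le_of_eq ?_) (add_le_add h1 h2)
    rw [← EReal.coe_mul, ← EReal.coe_mul, ← EReal.coe_add]
    congr 1; ring
  rw [eintegral_eq_sub hφ hc hcφ, eintegral_eq_sub hψ hd hdψ,
    eintegral_eq_sub hχ (by positivity) hlow, ← mul_coe_sub_add _ _ hα hβ]
  congr 1
  · rw [← lintegral_const_mul _ (hφ.add_const _).ereal_toENNReal,
      ← lintegral_const_mul _ (hψ.add_const _).ereal_toENNReal,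
      ← lintegral_add_left ((hφ.add_const _).ereal_toENNReal.const_mul _)]
    congr 1
    refine lintegral_congr fun x => ?_
    rw [h, toENNReal_comb_add hα hβ (hcφ x) (hdψ x)]
  · congr 1; ring

theorem eintegral_coe {u : X → ℝ} (hu : Integrable u M) :
    eintegral M (fun x => (u x : EReal)) = ((∫ x, u x ∂M : ℝ) : EReal) := by
  rw [integral_eq_lintegral_pos_part_sub_lintegral_neg_part hu]
  have h1 : ∫⁻ x, ENNReal.ofReal (u x) ∂M ≠ ⊤ :=
    ne_top_of_le_ne_top hu.2.ne (lintegral_mono fun x => Real.ofReal_le_enorm _)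
  have h2 : ∫⁻ x, ENNReal.ofReal (-u x) ∂M ≠ ⊤ :=
    ne_top_of_le_ne_top hu.neg.2.ne (lintegral_mono fun x => Real.ofReal_le_enorm _)
  unfold eintegral
  simp only [← EReal.coe_neg, EReal.real_coe_toENNReal]
  rw [EReal.coe_sub, EReal.coe_ennreal_toReal h1, EReal.coe_ennreal_toReal h2]

end Eintegral

/-! ### Measures on the ball and pairs of measures on the space and the sphere -/

/-- The embedding `x ↦ x / (1 + ‖x‖)` of `ℝⁿ` as the interior of the ball. -/
def toBall (x : E n) : Q n := ⟨(1 + ‖x‖)⁻¹ • x, by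
  rw [mem_closedBall_zero_iff, norm_smul, Real.norm_eq_abs, abs_of_pos (by positivity),
    inv_mul_le_one₀ (by positivity)]
  linarith⟩

/-- The inclusion of the sphere in the ball. -/
def sphereToBall (θ : S n) : Q n := ⟨θ, Metric.sphere_subset_closedBall θ.2⟩

theorem one_sub_norm_toBall (x : E n) : 1 - ‖(toBall x : E n)‖ = (1 + ‖x‖)⁻¹ := by
  have : (0 : ℝ) < 1 + ‖x‖ := by positivity
  change 1 - ‖(1 + ‖x‖)⁻¹ • x‖ = _
  rw [norm_smul, Real.norm_eq_abs, abs_of_pos (by positivity)]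
  field_simp; ring

theorem norm_sphereToBall (θ : S n) : ‖(sphereToBall θ : E n)‖ = 1 :=
  mem_sphere_zero_iff_norm.1 θ.2

theorem toBall_injective : Function.Injective (toBall : E n → Q n) := by
  intro x y h
  have h1 := one_sub_norm_toBall x
  rw [h, one_sub_norm_toBall y, inv_inj] at h1
  have h2 : (1 + ‖x‖)⁻¹ • x = (1 + ‖y‖)⁻¹ • y := congrArg Subtype.val h
  rw [h1] at h2
  exact smul_right_injective _ (inv_ne_zero (by positivity)) h2

theorem continuous_toBall : Continuous (toBall : E n → Q n) := by
  have h : Continuous fun x : E n => (1 + ‖x‖)⁻¹ :=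
    (continuous_const.add continuous_norm).inv₀ fun x : E n => show 1 + ‖x‖ ≠ 0 by positivity
  exact (h.smul continuous_id).subtype_mk _

theorem measurableEmbedding_toBall : MeasurableEmbedding (toBall : E n → Q n) :=
  continuous_toBall.measurableEmbedding toBall_injective

theorem measurableEmbedding_sphereToBall : MeasurableEmbedding (sphereToBall : S n → Q n) := by
  have hc : Continuous (sphereToBall : S n → Q n) := continuous_subtype_val.subtype_mk _
  exact hc.measurableEmbedding fun x y h =>
    Subtype.ext (show (x : E n) = y from congrArg (fun q : Q n => (q : E n)) h)

theorem disjoint_range_toBall_range_sphereToBall :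
    Disjoint (Set.range (toBall : E n → Q n)) (Set.range (sphereToBall : S n → Q n)) := by
  rw [Set.disjoint_left]
  rintro _ ⟨x, rfl⟩ ⟨θ, h⟩
  have h1 := one_sub_norm_toBall x
  rw [← h, norm_sphereToBall, sub_self] at h1
  exact absurd h1.symm (by positivity)

theorem range_toBall_union_range_sphereToBall :
    Set.range (toBall : E n → Q n) ∪ Set.range (sphereToBall : S n → Q n) = Set.univ := by
  refine Set.eq_univ_of_forall fun q => ?_
  rcases q.norm_le.eq_or_lt with h | h
  · exact Or.inr ⟨⟨q, mem_sphere_zero_iff_norm.2 h⟩, rfl⟩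
  · left
    have h1 : 0 < 1 - ‖(q : E n)‖ := by linarith
    refine ⟨(1 - ‖(q : E n)‖)⁻¹ • (q : E n), Subtype.ext ?_⟩
    change (1 + ‖(1 - ‖(q : E n)‖)⁻¹ • (q : E n)‖)⁻¹ • (1 - ‖(q : E n)‖)⁻¹ • (q : E n) = q
    rw [norm_smul, Real.norm_eq_abs, abs_of_pos (by positivity), smul_smul]
    have : (1 + (1 - ‖(q : E n)‖)⁻¹ * ‖(q : E n)‖)⁻¹ * (1 - ‖(q : E n)‖)⁻¹ = 1 := by
      field_simp; ring
    rw [this, one_smul]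

/-- The weight `1 + ‖x‖`. -/
def weight (x : E n) : ℝ≥0∞ := ENNReal.ofReal (1 + ‖x‖)

theorem measurable_weight : Measurable (weight : E n → ℝ≥0∞) := by
  unfold weight; fun_prop

theorem weight_ne_zero (x : E n) : weight x ≠ 0 := by
  have : (0 : ℝ) < 1 + ‖x‖ := by positivity
  simpa [weight] using this

theorem weight_ne_top (x : E n) : weight x ≠ ⊤ := ENNReal.ofReal_ne_top

/-- The measure on the ball `Q` which corresponds to `(μ, ν)`. -/
def ballMeasure (μ : Measure (E n)) (ν : Measure (S n)) : Measure (Q n) :=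
  (μ.withDensity weight).map toBall + ν.map sphereToBall

theorem lintegral_weight_ne_top {μ : Measure (E n)} [IsFiniteMeasure μ]
    (hμ : Integrable (fun x => ‖x‖) μ) : ∫⁻ x, weight x ∂μ ≠ ⊤ :=
  ((hasFiniteIntegral_iff_ofReal
    (Eventually.of_forall fun x => add_nonneg zero_le_one (norm_nonneg x))).1
    ((integrable_const (1 : ℝ)).add hμ).2).ne

theorem isFiniteMeasure_of_lintegral_weight {μ : Measure (E n)} (h : ∫⁻ x, weight x ∂μ ≠ ⊤) :
    IsFiniteMeasure μ ∧ Integrable (fun x => ‖x‖) μ := by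
  constructor
  · refine ⟨lt_of_le_of_lt ?_ h.lt_top⟩
    rw [← lintegral_one]
    refine lintegral_mono fun x => ?_
    rw [← ENNReal.ofReal_one]
    exact ENNReal.ofReal_le_ofReal (by linarith [norm_nonneg x])
  · refine ⟨by fun_prop, (hasFiniteIntegral_iff_ofReal
      (Eventually.of_forall fun x => norm_nonneg x)).2 (lt_of_le_of_lt ?_ h.lt_top)⟩
    exact lintegral_mono fun x => ENNReal.ofReal_le_ofReal (by linarith)

theorem isFiniteMeasure_ballMeasure {μ : Measure (E n)} {ν : Measure (S n)} [IsFiniteMeasure μ]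
    (hμ : Integrable (fun x => ‖x‖) μ) [IsFiniteMeasure ν] :
    IsFiniteMeasure (ballMeasure μ ν) := by
  have : IsFiniteMeasure (μ.withDensity weight) :=
    isFiniteMeasure_withDensity (lintegral_weight_ne_top hμ)
  unfold ballMeasure
  infer_instance

theorem lintegral_ballMeasure (μ : Measure (E n)) (ν : Measure (S n)) {ψ : Q n → ℝ≥0∞}
    (hψ : Measurable ψ) : ∫⁻ q, ψ q ∂(ballMeasure μ ν) =
      ∫⁻ x, weight x * ψ (toBall x) ∂μ + ∫⁻ θ, ψ (sphereToBall θ) ∂ν := by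
  rw [ballMeasure, lintegral_add_measure, measurableEmbedding_toBall.lintegral_map,
    measurableEmbedding_sphereToBall.lintegral_map,
    lintegral_withDensity_eq_lintegral_mul _ measurable_weight
      (g := fun x => ψ (toBall x)) (hψ.comp measurableEmbedding_toBall.measurable)]
  rfl

theorem comap_toBall_ballMeasure (μ : Measure (E n)) (ν : Measure (S n)) :
    (ballMeasure μ ν).comap toBall = μ.withDensity weight := by
  ext A hA
  rw [measurableEmbedding_toBall.comap_apply, ballMeasure, Measure.add_apply,
    measurableEmbedding_toBall.map_apply, measurableEmbedding_sphereToBall.map_apply,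
    Set.preimage_image_eq _ toBall_injective]
  have : sphereToBall ⁻¹' (toBall '' A) = (∅ : Set (S n)) := by
    refine Set.eq_empty_of_forall_notMem fun θ hθ => ?_
    obtain ⟨x, -, hx⟩ := hθ
    exact Set.disjoint_left.1 disjoint_range_toBall_range_sphereToBall ⟨x, rfl⟩ ⟨θ, hx.symm⟩
  rw [this, measure_empty, add_zero]

theorem comap_sphereToBall_ballMeasure (μ : Measure (E n)) (ν : Measure (S n)) :
    (ballMeasure μ ν).comap sphereToBall = ν := by
  ext A hA
  rw [measurableEmbedding_sphereToBall.comap_apply, ballMeasure, Measure.add_apply,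
    measurableEmbedding_toBall.map_apply, measurableEmbedding_sphereToBall.map_apply,
    Set.preimage_image_eq _ measurableEmbedding_sphereToBall.injective]
  have : toBall ⁻¹' (sphereToBall '' A) = (∅ : Set (E n)) := by
    refine Set.eq_empty_of_forall_notMem fun x hx => ?_
    obtain ⟨θ, -, hθ⟩ := hx
    exact Set.disjoint_left.1 disjoint_range_toBall_range_sphereToBall ⟨x, rfl⟩ ⟨θ, hθ⟩
  rw [this, measure_empty, zero_add]

/-- The two images are carried by disjoint sets, so pulling back along each embedding isolates one
summand; the weight is then divided out. -/
theorem ballMeasure_injective {μ μ' : Measure (E n)} {ν ν' : Measure (S n)}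
    (h : ballMeasure μ ν = ballMeasure μ' ν') : μ = μ' ∧ ν = ν' := by
  constructor
  · have h1 := congrArg (fun M => (Measure.comap toBall M).withDensity fun x => (weight x)⁻¹) h
    simp only [comap_toBall_ballMeasure] at h1
    rwa [withDensity_inv_same measurable_weight (Eventually.of_forall weight_ne_zero)
      (Eventually.of_forall weight_ne_top), withDensity_inv_same measurable_weight
      (Eventually.of_forall weight_ne_zero) (Eventually.of_forall weight_ne_top)] at h1
  · have h1 := congrArg (Measure.comap sphereToBall) h
    rwa [comap_sphereToBall_ballMeasure, comap_sphereToBall_ballMeasure] at h1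

/-- `M` is split into its parts on the open ball and on the sphere. Dividing the first by `1 + ‖x‖`
gives `μ`; finiteness of `∫ (1 + ‖x‖) dμ` encodes both finite mass and finite first moment. -/
theorem exists_ballMeasure_eq (M : Measure (Q n)) [IsFiniteMeasure M] :
    ∃ (μ : Measure (E n)) (ν : Measure (S n)), IsFiniteMeasure μ ∧
      Integrable (fun x => ‖x‖) μ ∧ IsFiniteMeasure ν ∧ ballMeasure μ ν = M := by
  have hw : ((M.comap toBall).withDensity fun x => (weight x)⁻¹).withDensity weight =
      M.comap toBall := by
    rw [← withDensity_mul _ (f := fun x => (weight x)⁻¹) measurable_weight.inv measurable_weight]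
    convert withDensity_one
    ext x
    exact ENNReal.inv_mul_cancel (weight_ne_zero x) (weight_ne_top x)
  have hfin : IsFiniteMeasure (M.comap (toBall : E n → Q n)) :=
    ⟨by rw [measurableEmbedding_toBall.comap_apply]; exact measure_lt_top _ _⟩
  have hfin' : IsFiniteMeasure (M.comap (sphereToBall : S n → Q n)) :=
    ⟨by rw [measurableEmbedding_sphereToBall.comap_apply]; exact measure_lt_top _ _⟩
  have h := isFiniteMeasure_of_lintegral_weight
    (μ := (M.comap toBall).withDensity fun x => (weight x)⁻¹) (by
      rw [← setLIntegral_univ, ← withDensity_apply _ MeasurableSet.univ, hw]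
      exact measure_ne_top _ _)
  refine ⟨_, M.comap sphereToBall, h.1, h.2, hfin', ?_⟩
  rw [ballMeasure, hw, measurableEmbedding_toBall.map_comap,
    measurableEmbedding_sphereToBall.map_comap, ← Measure.restrict_union
    disjoint_range_toBall_range_sphereToBall measurableEmbedding_sphereToBall.measurableSet_range,
    range_toBall_union_range_sphereToBall, Measure.restrict_univ]

/-- The factor `1 + ‖x‖` carries the cross-section point `toBall x` back to `(x, 1)` on the same
ray. -/
theorem weight_mul_toENNReal_ballSupport (f : LC n) (x : E n) :
    weight x * (ballSupport f (toBall x)).toENNReal = (supportFun f x).toENNReal ∧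
      weight x * (-ballSupport f (toBall x)).toENNReal = (-supportFun f x).toENNReal := by
  have hpos : (0 : ℝ) < 1 + ‖x‖ := by positivity
  have h : (((1 + ‖x‖ : ℝ)) : EReal) * ballSupport f (toBall x) = supportFun f x := by
    rw [supportFun_eq, ballSupport, one_sub_norm_toBall, ← persp_smul f hpos]
    change persp f ((1 + ‖x‖) • (1 + ‖x‖)⁻¹ • x) _ = _
    rw [smul_smul, mul_inv_cancel₀ hpos.ne', one_smul]
  have hw : weight x = (((1 + ‖x‖ : ℝ)) : EReal).toENNReal := rfl
  have hpos' : (0 : EReal) ≤ ((1 + ‖x‖ : ℝ) : EReal) := by exact_mod_cast hpos.le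
  rw [hw, ← EReal.toENNReal_mul hpos', ← EReal.toENNReal_mul hpos', h, mul_comm, EReal.neg_mul,
    mul_comm, h]
  exact ⟨rfl, rfl⟩

theorem ballSupport_sphereToBall (f : LC n) (θ : S n) :
    ballSupport f (sphereToBall θ) = setSupportFun (suppSet f) θ := by
  rw [setSupportFun_eq, ballSupport, norm_sphereToBall, sub_self]
  rfl

/-- The two differences of integrals may be merged into one because the negative parts have finite
integral. -/
theorem rieszFunctional_eq {μ : Measure (E n)} {ν : Measure (S n)} [IsFiniteMeasure μ]
    (hμ : Integrable (fun x => ‖x‖) μ) [IsFiniteMeasure ν] (f : LC n) :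
    rieszFunctional μ ν f = eintegral (ballMeasure μ ν) (ballSupport f) := by
  have := isFiniteMeasure_ballMeasure (ν := ν) hμ
  obtain ⟨c, -, hc⟩ := exists_forall_le_ballSupport f
  have hneg := lintegral_neg_ne_top (M := ballMeasure μ ν) hc
  rw [lintegral_ballMeasure μ ν (ψ := fun q => (-ballSupport f q).toENNReal)
    (measurable_ballSupport f).neg.ereal_toENNReal] at hneg
  unfold rieszFunctional eintegral
  rw [lintegral_ballMeasure μ ν (measurable_ballSupport f).ereal_toENNReal,
    lintegral_ballMeasure μ ν (ψ := fun q => (-ballSupport f q).toENNReal)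
    (measurable_ballSupport f).neg.ereal_toENNReal]
  simp only [(weight_mul_toENNReal_ballSupport f _).1, (weight_mul_toENNReal_ballSupport f _).2,
    ballSupport_sphereToBall] at hneg ⊢
  rw [EReal.coe_ennreal_add, EReal.coe_ennreal_add, EReal.add_sub_add_comm]
  · exact Or.inl (EReal.coe_ennreal_ne_bot _)
  · exact Or.inl (by simpa using (ENNReal.add_ne_top.1 hneg).1)

/-! ### Properties of the representing functional -/

theorem isClosedSupLinear_rieszFunctional {μ : Measure (E n)} {ν : Measure (S n)}
    [IsFiniteMeasure μ] (hμ : Integrable (fun x => ‖x‖) μ) [IsFiniteMeasure ν] :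
    IsClosedSupLinear (rieszFunctional μ ν) := by
  intro f g h α β hα hβ hh
  have := isFiniteMeasure_ballMeasure (ν := ν) hμ
  obtain ⟨c, hc, hcf⟩ := exists_forall_le_ballSupport f
  obtain ⟨d, hd, hdg⟩ := exists_forall_le_ballSupport g
  simp only [rieszFunctional_eq hμ]
  exact eintegral_comb (measurable_ballSupport f) (measurable_ballSupport g) hc hd hcf hdg
    (measurable_ballSupport h) hα hβ fun q => persp_eq_of_uscHull hα hβ hh _ q.nonneg

theorem isIncreasing_rieszFunctional {μ : Measure (E n)} {ν : Measure (S n)}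
    [IsFiniteMeasure μ] (hμ : Integrable (fun x => ‖x‖) μ) [IsFiniteMeasure ν] :
    IsIncreasing (rieszFunctional μ ν) := by
  intro f g h
  simp only [rieszFunctional_eq hμ]
  exact eintegral_mono fun q => persp_mono h _ q.nonneg

theorem isContinuousFromBelow_rieszFunctional {μ : Measure (E n)} {ν : Measure (S n)}
    [IsFiniteMeasure μ] (hμ : Integrable (fun x => ‖x‖) μ) [IsFiniteMeasure ν] :
    IsContinuousFromBelow (rieszFunctional μ ν) := by
  intro u f hmono hlim
  have := isFiniteMeasure_ballMeasure (ν := ν) hμ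
  obtain ⟨c, hc, hcu⟩ := exists_forall_le_ballSupport (u 0)
  simp only [rieszFunctional_eq hμ]
  exact tendsto_eintegral_of_monotone (fun i => measurable_ballSupport (u i))
    (fun q => monotone_persp hmono _ q.nonneg) (fun q => persp_eq_iSup hmono hlim _ q.nonneg) hc hcu

theorem rieszFunctional_ne_bot {μ : Measure (E n)} {ν : Measure (S n)}
    [IsFiniteMeasure μ] (hμ : Integrable (fun x => ‖x‖) μ) [IsFiniteMeasure ν] (f : LC n) :
    rieszFunctional μ ν f ≠ ⊥ := by
  have := isFiniteMeasure_ballMeasure (ν := ν) hμ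
  obtain ⟨c, -, hc⟩ := exists_forall_le_ballSupport f
  rw [rieszFunctional_eq hμ]
  exact eintegral_ne_bot hc

theorem Body.rieszFunctional_toLC {μ : Measure (E n)} {ν : Measure (S n)}
    [IsFiniteMeasure μ] (hμ : Integrable (fun x => ‖x‖) μ) [IsFiniteMeasure ν] (C : Body n) :
    rieszFunctional μ ν C.toLC = ((∫ q, C.supp q ∂(ballMeasure μ ν) : ℝ) : EReal) := by
  have := isFiniteMeasure_ballMeasure (ν := ν) hμ
  rw [rieszFunctional_eq hμ, show ballSupport C.toLC = fun q => (C.supp q : EReal) from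
    funext C.ballSupport_toLC]
  exact eintegral_coe (C.supp.continuous.integrable_of_hasCompactSupport
    (HasCompactSupport.of_compactSpace _))

theorem Body.toLC_disc (x : E n) {r : ℝ} (hr : 0 ≤ r) (t : ℝ) {y : E n}
    (hy : y ∈ Metric.closedBall x r) : ((Body.disc x hr t).toLC y : ℝ) = Real.exp t := by
  refine Body.toLC_eq_of_forall_le _ (show (y, t) ∈ (Body.disc x hr t).carrier from ⟨hy, rfl⟩) ?_
  rintro s ⟨-, hs⟩
  exact le_of_eq hs

theorem Body.toLC_disc_eq_zero (x : E n) {r : ℝ} (hr : 0 ≤ r) (t : ℝ) {y : E n}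
    (hy : y ∉ Metric.closedBall x r) : (Body.disc x hr t).toLC y = 0 :=
  Body.toLC_eq_zero _ fun _ hs => hy hs.1

theorem Body.lintegral_toLC_disc_pos (x : E n) {r : ℝ} (hr : 0 < r) (t : ℝ) :
    0 < ∫⁻ y, ((Body.disc x hr.le t).toLC y : ℝ≥0∞) := by
  have h1 : ∫⁻ _ in Metric.closedBall x r, ENNReal.ofReal (Real.exp t) ≤
      ∫⁻ y, ((Body.disc x hr.le t).toLC y : ℝ≥0∞) := by
    refine le_trans (setLIntegral_mono' Metric.isClosed_closedBall.measurableSet fun y hy => ?_)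
      (setLIntegral_le_lintegral _ _)
    rw [← Body.toLC_disc x hr.le t hy, ENNReal.ofReal_coe_nnreal]
  refine lt_of_lt_of_le ?_ h1
  rw [setLIntegral_const]
  exact ENNReal.mul_pos (by simpa using Real.exp_pos t) (Metric.measure_closedBall_pos _ _ hr).ne'

/-! ### Approximation by compact convex sets -/

theorem Body.toLC_le_of_subset {C D : Body n} (h : C.carrier ⊆ D.carrier) (x : E n) :
    C.toLC x ≤ D.toLC x :=
  Body.toLC_mono (fun q => C.supp_le fun _ hz => D.pair_le_supp q (h hz)) x

theorem LC.convex_hypograph (f : LC n) :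
    Convex ℝ {z : E n × ℝ | Real.exp z.2 ≤ f z.1} := by
  rintro ⟨x, s⟩ hx ⟨y, t⟩ hy a b ha hb hab
  have hx' : (0 : ℝ) < f x := (Real.exp_pos s).trans_le hx
  have hy' : (0 : ℝ) < f y := (Real.exp_pos t).trans_le hy
  have hs : s ≤ Real.log (f x) := (Real.le_log_iff_exp_le hx').2 hx
  have ht : t ≤ Real.log (f y) := (Real.le_log_iff_exp_le hy').2 hy
  obtain rfl : a = 1 - b := by linarith
  obtain ⟨hpos, hle⟩ := f.log_le (by exact_mod_cast hx') (by exact_mod_cast hy') hb (by linarith)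
  change Real.exp ((1 - b) * s + b * t) ≤ f ((1 - b) • x + b • y)
  rw [← Real.le_log_iff_exp_le (by exact_mod_cast hpos)]
  have h1 := mul_le_mul_of_nonneg_left hs ha
  have h2 := mul_le_mul_of_nonneg_left ht hb
  linarith

theorem LC.isClosed_hypograph (f : LC n) : IsClosed {z : E n × ℝ | Real.exp z.2 ≤ f z.1} := by
  have h : Continuous fun z : E n × ℝ => (z.1, (Real.exp z.2).toNNReal) := by fun_prop
  convert (UpperSemicontinuous.IsClosed_hypograph f.upper_semicontinuous).preimage h using 1
  ext z
  exact (Real.toNNReal_le_iff_le_coe).symm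

theorem LC.exists_forall_le_on_closedBall (f : LC n) (R : ℝ) :
    ∃ T : ℝ, ∀ x ∈ Metric.closedBall (0 : E n) R, 0 < f x → Real.log (f x) ≤ T := by
  obtain ⟨b, hb⟩ := (f.upper_semicontinuous.upperSemicontinuousOn _).bddAbove_of_isCompact
    (isCompact_closedBall (0 : E n) R)
  refine ⟨Real.log b, fun x hx hpos => Real.log_le_log (by exact_mod_cast hpos) ?_⟩
  exact_mod_cast hb ⟨x, hx, rfl⟩

/-- The part of the hypograph of `log f` with `‖x‖ ≤ R` and `t ≥ a`. -/
def LC.trunc (f : LC n) (R a : ℝ)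
    (h : ∃ x, ‖x‖ ≤ R ∧ Real.exp a ≤ f x) : Body n where
  carrier := {z | Real.exp z.2 ≤ f z.1} ∩ Metric.closedBall 0 R ×ˢ Set.Ici a
  convex := f.convex_hypograph.inter ((convex_closedBall _ _).prod (convex_Ici a))
  isCompact := by
    obtain ⟨T, hT⟩ := f.exists_forall_le_on_closedBall R
    refine ((isCompact_closedBall (0 : E n) R).prod (isCompact_Icc (a := a) (b := T))
      ).of_isClosed_subset
      (f.isClosed_hypograph.inter (Metric.isClosed_closedBall.prod isClosed_Ici)) ?_
    rintro ⟨x, t⟩ ⟨h1, h2, h3⟩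
    have h1' : (0 : ℝ) < f x := (Real.exp_pos t).trans_le h1
    exact ⟨h2, h3, ((Real.le_log_iff_exp_le h1').2 h1).trans (hT x h2 (by exact_mod_cast h1'))⟩
  nonempty := by
    obtain ⟨x, h1, h2⟩ := h
    exact ⟨(x, a), h2, by simpa using h1, Set.mem_Ici.2 le_rfl⟩

theorem LC.exists_body_approx (f : LC n) : ∃ u : ℕ → Body n,
    (∀ x, Monotone fun i => (u i).toLC x) ∧
      ∀ x, Tendsto (fun i => (u i).toLC x) atTop (𝓝 (f x)) := by
  obtain ⟨x₀, hx₀⟩ := f.exists_pos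
  have hx₀' : (0 : ℝ) < f x₀ := by exact_mod_cast hx₀
  -- The radii and levels are chosen so that `x₀` belongs to every truncation, which keeps all of
  -- them nonempty.
  have hne : ∀ i : ℕ, ∃ x, ‖x‖ ≤ ‖x₀‖ + i ∧ Real.exp (Real.log (f x₀) - i) ≤ f x := fun i =>
    ⟨x₀, by simp, (Real.le_log_iff_exp_le hx₀').1 (by simp)⟩
  refine ⟨fun i => f.trunc _ _ (hne i), fun x i j hij => Body.toLC_le_of_subset ?_ x, fun x => ?_⟩
  · have hij' : (i : ℝ) ≤ j := by exact_mod_cast hij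
    refine Set.inter_subset_inter_right _ (Set.prod_mono ?_ ?_)
    · exact Metric.closedBall_subset_closedBall (by linarith)
    · exact Set.Ici_subset_Ici.2 (by linarith)
  · refine tendsto_nhds_of_eventually_eq ?_
    rcases (show 0 ≤ f x from zero_le).eq_or_lt with hx | hx
    · refine Eventually.of_forall fun i => ?_
      rw [← hx]
      refine Body.toLC_eq_zero _ fun s hs => ?_
      have := (Real.exp_pos s).trans_le hs.1
      simp [← hx] at this
    · have hx' : (0 : ℝ) < f x := by exact_mod_cast hx
      -- From this index on, `(x, log f(x))` lies in the truncated hypograph, so the approximation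
      -- equals `f` at `x`.
      obtain ⟨N, hN⟩ := exists_nat_ge (‖x‖ + |Real.log (f x₀)| + |Real.log (f x)|)
      filter_upwards [eventually_ge_atTop N] with i hi
      have hi' : (N : ℝ) ≤ i := by exact_mod_cast hi
      rw [← NNReal.coe_inj, ← Real.exp_log hx']
      refine Body.toLC_eq_of_forall_le _ ⟨(Real.exp_log hx').le, ?_, ?_⟩ fun s hs =>
        (Real.le_log_iff_exp_le hx').2 hs.1
      · rw [mem_closedBall_zero_iff]
        have := abs_nonneg (Real.log (f x₀))
        have := abs_nonneg (Real.log (f x))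
        have := norm_nonneg x₀
        dsimp only
        linarith
      · refine Set.mem_Ici.2 ?_
        have := le_abs_self (Real.log (f x₀))
        have := neg_abs_le (Real.log (f x))
        have := norm_nonneg x
        dsimp only
        linarith

/-! ### Measures on the ball and functionals of compact convex sets -/

theorem exists_supp_sub_supp_eq_affine (w : E n) (b : ℝ) :
    ∃ C D : Body n, ∀ q, C.supp q - D.supp q = inner ℝ w (q : E n) + b := by
  refine ⟨Body.disc w (le_max_right b 0) (max b 0),
    Body.disc 0 (le_max_right (-b) 0) (max (-b) 0), fun q => ?_⟩
  rw [Body.supp_disc, Body.supp_disc, inner_zero_left]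
  have : max b 0 - max (-b) 0 = b := by
    rcases le_total b 0 with h | h
    · rw [max_eq_right h, max_eq_left (by linarith)]; ring
    · rw [max_eq_left h, max_eq_right (by linarith)]; ring
  linear_combination this

/-- This is the lattice form of Stone-Weierstrass. The identity `min (c - d) (c' - d') = c + c' -
max (c' + d) (c + d')` and its dual keep the set closed under lattice operations, as a maximum of
support functions is that of a convex hull. Affine functions interpolate any two values. -/
theorem closure_supp_sub_supp :
    closure {u : C(Q n, ℝ) | ∃ C D : Body n, ∀ q, u q = C.supp q - D.supp q} = ⊤ := by
  have hadd : ∀ (C D : Body n) q, (Body.comb 1 1 C D).supp q = C.supp q + D.supp q := by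
    intro C D q
    rw [Body.supp_comb zero_le_one zero_le_one, one_mul, one_mul]
  apply ContinuousMap.sublattice_closure_eq_top
  · exact ⟨0, Body.point 0, Body.point 0, fun q => by simp⟩
  · rintro u ⟨C, D, hu⟩ v ⟨C', D', hv⟩
    refine ⟨Body.comb 1 1 C C', Body.hull (Body.comb 1 1 C' D) (Body.comb 1 1 C D'), fun q => ?_⟩
    rw [ContinuousMap.inf_apply, hu, hv, Body.supp_hull, hadd, hadd, hadd]
    rcases le_total (C'.supp q + D.supp q) (C.supp q + D'.supp q) with h | h
    · rw [max_eq_right h, inf_eq_right.2 (by linarith)]; ring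
    · rw [max_eq_left h, inf_eq_left.2 (by linarith)]; ring
  · rintro u ⟨C, D, hu⟩ v ⟨C', D', hv⟩
    refine ⟨Body.hull (Body.comb 1 1 C' D) (Body.comb 1 1 C D'), Body.comb 1 1 D D', fun q => ?_⟩
    rw [ContinuousMap.sup_apply, hu, hv, Body.supp_hull, hadd, hadd, hadd]
    rcases le_total (C'.supp q + D.supp q) (C.supp q + D'.supp q) with h | h
    · rw [max_eq_right h, sup_eq_left.2 (by linarith)]; ring
    · rw [max_eq_left h, sup_eq_right.2 (by linarith)]; ring
  · intro v x y
    obtain ⟨w, b, h1, h2⟩ : ∃ (w : E n) (b : ℝ), inner ℝ w (x : E n) + b = v x ∧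
        inner ℝ w (y : E n) + b = v y := by
      rcases eq_or_ne x y with rfl | hxy
      · exact ⟨0, v x, by simp, by simp⟩
      · have hne : ‖(x : E n) - y‖ ^ 2 ≠ 0 :=
          pow_ne_zero _ (norm_ne_zero_iff.2 (sub_ne_zero.2 fun h => hxy (Subtype.ext h)))
        have h3 : inner ℝ (((v x - v y) / ‖(x : E n) - y‖ ^ 2) • ((x : E n) - y))
            ((x : E n) - y) = v x - v y := by
          rw [real_inner_smul_left, real_inner_self_eq_norm_sq, div_mul_cancel₀ _ hne]
        rw [inner_sub_right] at h3
        exact ⟨_, v x - inner ℝ (((v x - v y) / ‖(x : E n) - y‖ ^ 2) • ((x : E n) - y)) (x : E n),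
          by ring, by linarith⟩
    obtain ⟨C, D, hCD⟩ := exists_supp_sub_supp_eq_affine w b
    exact ⟨C.supp - D.supp, ⟨C, D, fun q => rfl⟩, (hCD x).trans h1, (hCD y).trans h2⟩

theorem measure_eq_of_integral_supp_eq {M M' : Measure (Q n)} [IsFiniteMeasure M]
    [IsFiniteMeasure M'] (h : ∀ C : Body n, ∫ q, C.supp q ∂M = ∫ q, C.supp q ∂M') : M = M' := by
  have hint : ∀ (N : Measure (Q n)) [IsFiniteMeasure N] (u : C(Q n, ℝ)),
      Integrable (fun q => u q) N := fun N _ u =>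
    u.continuous.integrable_of_hasCompactSupport (HasCompactSupport.of_compactSpace _)
  -- The integral is Lipschitz in the sup norm with constant the total mass, so equality passes to
  -- the closure.
  have hcont : ∀ (N : Measure (Q n)) [IsFiniteMeasure N],
      Continuous fun u : C(Q n, ℝ) => ∫ q, u q ∂N := by
    intro N _
    refine LipschitzWith.continuous (K := (N.real Set.univ).toNNReal)
      (LipschitzWith.of_dist_le_mul fun u v => ?_)
    rw [Real.dist_eq, ← integral_sub (hint N u) (hint N v), Real.coe_toNNReal _ measureReal_nonneg,
      mul_comm, ← Real.norm_eq_abs]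
    refine norm_integral_le_of_norm_le_const (μ := N) (Eventually.of_forall fun q => ?_)
    rw [← dist_eq_norm]
    exact ContinuousMap.dist_apply_le_dist q
  have hall : ∀ u : C(Q n, ℝ), ∫ q, u q ∂M = ∫ q, u q ∂M' := by
    intro u
    have hcl : IsClosed {u : C(Q n, ℝ) | ∫ q, u q ∂M = ∫ q, u q ∂M'} :=
      isClosed_eq (hcont M) (hcont M')
    refine closure_minimal ?_ hcl (show u ∈ closure {u : C(Q n, ℝ) | ∃ C D : Body n,
      ∀ q, u q = C.supp q - D.supp q} by rw [closure_supp_sub_supp]; trivial)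
    rintro u ⟨C, D, hu⟩
    change ∫ q, u q ∂M = ∫ q, u q ∂M'
    simp_rw [hu]
    rw [integral_sub (hint M _) (hint M _), integral_sub (hint M' _) (hint M' _), h, h]
  exact ext_of_forall_integral_eq_of_IsFiniteMeasure fun u => hall u.toContinuousMap

theorem exists_measure_of_positive (Λ : C(Q n, ℝ) →ₗ[ℝ] ℝ) (hΛ : ∀ u, 0 ≤ u → 0 ≤ Λ u) :
    ∃ M : Measure (Q n), IsFiniteMeasure M ∧ ∀ u : C(Q n, ℝ), ∫ q, u q ∂M = Λ u := by
  let T : CompactlySupportedContinuousMap (Q n) ℝ →ₗ[ℝ] ℝ :=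
    { toFun := fun u => Λ u.toContinuousMap
      map_add' := fun u v => map_add Λ u.toContinuousMap v.toContinuousMap
      map_smul' := fun c u => map_smul Λ c u.toContinuousMap }
  let T' := PositiveLinearMap.mk₀ T fun u hu => hΛ _ hu
  exact ⟨RealRMK.rieszMeasure T', inferInstance, fun u =>
    RealRMK.integral_rieszMeasure T' (CompactlySupportedContinuousMap.continuousMapEquiv u)⟩

/-- A linear increasing functional of compact convex sets is the integral of the support function
with respect to a measure. -/
theorem exists_measure_of_body_functional (G : Body n → ℝ)
    (hlin : ∀ (C D : Body n) (α β : ℝ), 0 < α → 0 < β →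
      G (Body.comb α β C D) = α * G C + β * G D)
    (hmono : ∀ C D : Body n, (∀ q, C.supp q ≤ D.supp q) → G C ≤ G D) :
    ∃ M : Measure (Q n), IsFiniteMeasure M ∧ ∀ C : Body n, ∫ q, C.supp q ∂M = G C := by
  have hball : ∀ r : ℝ, 0 ≤ r → ∃ B : Body n, ∀ q, B.supp q = r := fun r hr =>
    ⟨Body.disc 0 hr r, fun q => by rw [Body.supp_disc, inner_zero_left]; ring⟩
  obtain ⟨Z, hZ⟩ := hball 0 le_rfl
  have hGZ : G Z = 0 := by
    have h1 := hlin Z Z 1 1 one_pos one_pos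
    have h2 : ∀ q, (Body.comb 1 1 Z Z).supp q = Z.supp q := fun q => by
      rw [Body.supp_comb zero_le_one zero_le_one, hZ]; ring
    have h3 := le_antisymm (hmono _ _ fun q => (h2 q).le) (hmono _ _ fun q => (h2 q).ge)
    linarith
  -- The infimum of `T u` is the least cost of dominating `u` by a difference of support functions;
  -- it is a finite sublinear functional.
  let T : C(Q n, ℝ) → Set ℝ := fun u =>
    {r | ∃ C D : Body n, (∀ q, u q ≤ C.supp q - D.supp q) ∧ r = G C - G D}
  have hne : ∀ u, (T u).Nonempty := by
    intro u
    obtain ⟨B, hB⟩ := hball ‖u‖ (norm_nonneg u)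
    refine ⟨_, B, Z, fun q => ?_, rfl⟩
    rw [hB, hZ, sub_zero]
    exact (le_abs_self _).trans (u.norm_coe_le_norm q)
  have hbdd : ∀ u, BddBelow (T u) := by
    intro u
    obtain ⟨B, hB⟩ := hball ‖u‖ (norm_nonneg u)
    refine ⟨-G B, ?_⟩
    rintro _ ⟨C, D, h, rfl⟩
    have h1 := hmono D (Body.comb 1 1 C B) fun q => by
      rw [Body.supp_comb zero_le_one zero_le_one, hB]
      have := (neg_abs_le _).trans (h q)
      have := u.norm_coe_le_norm q
      rw [Real.norm_eq_abs] at this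
      linarith
    rw [hlin _ _ _ _ one_pos one_pos] at h1
    linarith
  have hsmul : ∀ c : ℝ, 0 < c → ∀ u, sInf (T (c • u)) ≤ c * sInf (T u) := by
    intro c hc u
    rw [mul_comm, ← div_le_iff₀ hc]
    refine le_csInf (hne u) ?_
    rintro _ ⟨C, D, h, rfl⟩
    rw [div_le_iff₀ hc]
    -- The dilate `c C` is written as `(c/2) C + (c/2) C`, so that additivity of `G` applies to it.
    refine csInf_le (hbdd _) ⟨Body.comb (c / 2) (c / 2) C C, Body.comb (c / 2) (c / 2) D D,
      fun q => ?_, ?_⟩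
    · rw [Body.supp_comb (by positivity) (by positivity),
        Body.supp_comb (by positivity) (by positivity), ContinuousMap.smul_apply, smul_eq_mul]
      have := mul_le_mul_of_nonneg_left (h q) hc.le
      linarith
    · rw [hlin _ _ _ _ (by positivity) (by positivity),
        hlin _ _ _ _ (by positivity) (by positivity)]
      ring
  -- Extending from the zero subspace suffices: domination applied to `C.supp` and to `-C.supp`
  -- forces `Λ` to agree with `G`, and applied to nonpositive functions it forces positivity.
  obtain ⟨Λ, -, hΛ⟩ := exists_extension_of_le_sublinear (⊥ : C(Q n, ℝ) →ₗ.[ℝ] ℝ)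
    (fun u => sInf (T u)) (fun c hc u => by
      refine le_antisymm (hsmul c hc u) ?_
      have := hsmul c⁻¹ (inv_pos.2 hc) (c • u)
      rw [smul_smul, inv_mul_cancel₀ hc.ne', one_smul] at this
      rwa [inv_mul_eq_div, le_div_iff₀ hc, mul_comm] at this) (fun u v => by
      rw [← sub_le_iff_le_add]
      refine le_csInf (hne u) ?_
      rintro _ ⟨C, D, h, rfl⟩
      rw [sub_le_comm]
      refine le_csInf (hne v) ?_
      rintro _ ⟨C', D', h', rfl⟩
      rw [sub_le_iff_le_add']
      refine csInf_le (hbdd _) ⟨Body.comb 1 1 C C', Body.comb 1 1 D D', fun q => ?_, ?_⟩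
      · rw [Body.supp_comb zero_le_one zero_le_one, Body.supp_comb zero_le_one zero_le_one,
          ContinuousMap.add_apply]
        linarith [h q, h' q]
      · rw [hlin _ _ _ _ one_pos one_pos, hlin _ _ _ _ one_pos one_pos]; ring) (by
      rintro ⟨u, hu⟩
      obtain rfl : u = 0 := (Submodule.mem_bot ℝ).1 hu
      have : (⊥ : C(Q n, ℝ) →ₗ.[ℝ] ℝ) ⟨0, hu⟩ = 0 := map_zero (⊥ : C(Q n, ℝ) →ₗ.[ℝ] ℝ).toFun
      rw [this]
      refine le_csInf (hne 0) ?_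
      rintro _ ⟨C, D, h, rfl⟩
      exact sub_nonneg.2 (hmono _ _ fun q => sub_nonneg.1 (h q)))
  have hle : ∀ (u : C(Q n, ℝ)) (C D : Body n), (∀ q, u q ≤ C.supp q - D.supp q) →
      Λ u ≤ G C - G D := fun u C D h => (hΛ u).trans (csInf_le (hbdd u) ⟨C, D, h, rfl⟩)
  obtain ⟨M, hM, hint⟩ := exists_measure_of_positive Λ fun u hu => by
    have := hle (-u) Z Z fun q => by
      rw [sub_self, ContinuousMap.neg_apply]
      exact neg_nonpos.2 (hu q)
    rw [map_neg] at this
    linarith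
  refine ⟨M, hM, fun C => (hint C.supp).trans (le_antisymm ?_ ?_)⟩
  · have := hle C.supp C Z fun q => by rw [hZ, sub_zero]
    linarith
  · have := hle (-C.supp) Z C fun q => by rw [hZ, zero_sub, ContinuousMap.neg_apply]
    rw [map_neg] at this
    linarith

/-! ### Linear increasing functionals on log-concave functions -/

theorem exists_disc_le (f : LC n) (h : 0 < ∫⁻ x, (f x : ℝ≥0∞)) :
    ∃ (x : E n) (r t : ℝ) (hr : 0 < r), ∀ y, (Body.disc x hr.le t).toLC y ≤ f y := by
  obtain ⟨k, hk⟩ : ∃ k : ℕ, volume {x | Real.exp (-(k : ℝ)) ≤ f x} ≠ 0 := by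
    by_contra hcon
    push Not at hcon
    have h0 : volume (⋃ k : ℕ, {x | Real.exp (-(k : ℝ)) ≤ f x}) = 0 := measure_iUnion_null hcon
    have hae : (fun x => (f x : ℝ≥0∞)) =ᵐ[volume] 0 := by
      refine measure_mono_null (fun x hx => ?_) h0
      have hpos : (0 : ℝ) < f x := by
        have : f x ≠ 0 := fun h => hx (by simp [h])
        exact_mod_cast pos_iff_ne_zero.2 this
      obtain ⟨k, hk⟩ := exists_nat_ge (-Real.log (f x))
      exact Set.mem_iUnion.2 ⟨k, (Real.le_log_iff_exp_le hpos).1 (by linarith)⟩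
    rw [lintegral_congr_ae hae] at h
    simp at h
  set A : Set (E n) := {x | Real.exp (-(k : ℝ)) ≤ f x}
  have hA : Convex ℝ A := by
    intro x hx y hy a b ha hb hab
    have := f.convex_hypograph (x := (x, -(k : ℝ))) hx (y := (y, -(k : ℝ))) hy ha hb hab
    have h2 : a • (-(k : ℝ)) + b • (-(k : ℝ)) = -(k : ℝ) := by
      rw [← add_smul, hab, one_smul]
    change Real.exp (a • (-(k : ℝ)) + b • (-(k : ℝ))) ≤ f (a • x + b • y) at this
    rwa [h2] at this
  -- A convex set has null frontier, so a convex superlevel set of positive measure has interior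
  -- points.
  have hint : (interior A).Nonempty := by
    by_contra hempty
    refine hk (measure_mono_null (fun x hx => ?_) (hA.addHaar_frontier volume))
    rw [frontier, Set.not_nonempty_iff_eq_empty.1 hempty, Set.sdiff_empty]
    exact subset_closure hx
  obtain ⟨x, hx⟩ := hint
  obtain ⟨r, hr, hball⟩ := Metric.nhds_basis_closedBall.mem_iff.1 (mem_interior_iff_mem_nhds.1 hx)
  refine ⟨x, r, -(k : ℝ), hr, fun y => ?_⟩
  by_cases hy : y ∈ Metric.closedBall x r
  · rw [← NNReal.coe_le_coe, Body.toLC_disc x hr.le _ hy]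
    exact hball hy
  · rw [Body.toLC_disc_eq_zero x hr.le _ hy]
    exact zero_le

theorem IsSupLinear.comb {F : LC n → EReal} (hlin : IsSupLinear F) (C D : Body n) {α β : ℝ}
    (hα : 0 < α) (hβ : 0 < β) : F (Body.comb α β C D).toLC =
      (α : EReal) * F C.toLC + (β : EReal) * F D.toLC :=
  hlin _ _ _ α β hα hβ (Body.toLC_comb hα hβ C D)

/-- The functional is finite on functions attached to compact convex sets. -/
theorem Body.map_toLC_ne_top {F : LC n → EReal} (hbot : ∀ f, F f ≠ ⊥) (hlin : IsSupLinear F)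
    (hinc : IsIncreasing F)
    (h₀ : ∃ f₀ : LC n, 0 < ∫⁻ x, (f₀ x : ℝ≥0∞) ∧ F f₀ < ⊤) (C : Body n) : F C.toLC ≠ ⊤ := by
  obtain ⟨f₀, hpos, hfin⟩ := h₀
  obtain ⟨x, r, t, hr, hle⟩ := exists_disc_le f₀ hpos
  have hdisc : F (Body.disc x hr.le t).toLC < ⊤ := (hinc _ _ hle).trans_lt hfin
  obtain ⟨R, hR, hCR⟩ : ∃ R : ℝ, 0 < R ∧ C.carrier ⊆ Metric.closedBall 0 R := by
    obtain ⟨R, hR⟩ := C.isCompact.isBounded.subset_closedBall 0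
    exact ⟨max R 1, by positivity, hR.trans (Metric.closedBall_subset_closedBall (le_max_left _ _))⟩
  have hCD : F C.toLC ≤ F (Body.disc 0 hR.le R).toLC := by
    refine hinc _ _ (Body.toLC_mono fun q => C.supp_le fun z hz => ?_)
    rw [Body.supp_disc, inner_zero_left, pair]
    have hz' := mem_closedBall_zero_iff.1 (hCR hz)
    have h1 : inner ℝ z.1 (q : E n) ≤ R * ‖(q : E n)‖ :=
      (real_inner_le_norm _ _).trans
        (mul_le_mul_of_nonneg_right ((norm_fst_le z).trans hz') (norm_nonneg _))
    have h2 : (1 - ‖(q : E n)‖) * z.2 ≤ (1 - ‖(q : E n)‖) * R :=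
      mul_le_mul_of_nonneg_left ((le_abs_self _).trans ((norm_snd_le z).trans hz')) q.nonneg
    linarith
  -- A shrunken copy of the large disc containing the bound for `C` is a Minkowski summand of the
  -- disc below `f₀`: radii add as `r/2 + r/2 = r` and heights as `r/2 + (t - r/2) = t`. An infinite
  -- value on the large disc would make the value on the small one infinite.
  have hα : 0 < r / (2 * R) := by positivity
  have hcomb : Body.toLC (Body.comb (r / (2 * R)) 1 (Body.disc 0 hR.le R)
      (Body.disc x (half_pos hr).le (t - r / 2))) = (Body.disc x hr.le t).toLC := by
    refine Body.toLC_eq_of_supp_eq fun q => ?_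
    rw [Body.supp_comb hα.le zero_le_one, Body.supp_disc, Body.supp_disc, Body.supp_disc,
      inner_zero_left]
    field_simp
    ring
  rw [← hcomb, hlin.comb _ _ hα one_pos, EReal.coe_one, one_mul] at hdisc
  intro htop
  rw [htop, top_le_iff] at hCD
  rw [hCD, EReal.coe_mul_top_of_pos hα, EReal.top_add_of_ne_bot (hbot _)] at hdisc
  exact lt_irrefl _ hdisc

/-- Every linear, increasing functional which is continuous from below is represented by a pair
of measures. -/
theorem exists_rieszFunctional {F : LC n → EReal} (hbot : ∀ f, F f ≠ ⊥) (hlin : IsSupLinear F)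
    (hinc : IsIncreasing F)
    (h₀ : ∃ f₀ : LC n, 0 < ∫⁻ x, (f₀ x : ℝ≥0∞) ∧ F f₀ < ⊤) (hcont : IsContinuousFromBelow F) :
    ∃ (μ : Measure (E n)) (ν : Measure (S n)), IsFiniteMeasure μ ∧
      Integrable (fun x => ‖x‖) μ ∧ IsFiniteMeasure ν ∧ ∀ f, F f = rieszFunctional μ ν f := by
  have hG : ∀ C : Body n, (((F C.toLC).toReal : ℝ) : EReal) = F C.toLC := fun C =>
    EReal.coe_toReal (Body.map_toLC_ne_top hbot hlin hinc h₀ C) (hbot _)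
  obtain ⟨M, hM, hint⟩ := exists_measure_of_body_functional (fun C : Body n => (F C.toLC).toReal)
    (fun C D α β hα hβ => by
      rw [← EReal.coe_eq_coe_iff, EReal.coe_add, EReal.coe_mul, EReal.coe_mul, hG, hG, hG,
        hlin.comb C D hα hβ])
    (fun C D h => by
      rw [← EReal.coe_le_coe_iff, hG, hG]
      exact hinc _ _ (Body.toLC_mono h))
  obtain ⟨μ, ν, hμ, hμ', hν, rfl⟩ := exists_ballMeasure_eq M
  refine ⟨μ, ν, hμ, hμ', hν, fun f => ?_⟩
  obtain ⟨u, hmono, hlim⟩ := f.exists_body_approx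
  have h1 := hcont (fun i => (u i).toLC) f hmono hlim
  have h2 := isContinuousFromBelow_rieszFunctional (ν := ν) hμ' (fun i => (u i).toLC) f hmono hlim
  -- The two functionals agree on all bodies, and both are continuous along the approximating
  -- sequence.
  refine tendsto_nhds_unique h1 (h2.congr fun i => ?_)
  rw [Body.rieszFunctional_toLC hμ', hint, hG]

theorem rieszFunctional_injective {μ μ' : Measure (E n)} {ν ν' : Measure (S n)}
    [IsFiniteMeasure μ] (hμ : Integrable (fun x => ‖x‖) μ) [IsFiniteMeasure ν]
    [IsFiniteMeasure μ'] (hμ' : Integrable (fun x => ‖x‖) μ') [IsFiniteMeasure ν']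
    (h : ∀ f, rieszFunctional μ ν f = rieszFunctional μ' ν' f) : μ = μ' ∧ ν = ν' := by
  have := isFiniteMeasure_ballMeasure (ν := ν) hμ
  have := isFiniteMeasure_ballMeasure (ν := ν') hμ'
  refine ballMeasure_injective (measure_eq_of_integral_supp_eq fun C => ?_)
  have := h C.toLC
  rwa [Body.rieszFunctional_toLC hμ, Body.rieszFunctional_toLC hμ', EReal.coe_eq_coe_iff] at this

end LogConcaveRiesz

end

theorem mainTheorem1 (n : ℕ) :
    (∀ F : LogConcaveRiesz.LC n → EReal,
      (∀ f, F f ≠ ⊥) →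
      LogConcaveRiesz.IsSupLinear F →
      LogConcaveRiesz.IsIncreasing F →
      (∃ f₀ : LogConcaveRiesz.LC n, 0 < ∫⁻ x, (f₀ x : ℝ≥0∞) ∧ F f₀ < ⊤) →
      LogConcaveRiesz.IsContinuousFromBelow F →
      ∃! p : Measure (LogConcaveRiesz.E n) × Measure (LogConcaveRiesz.S n),
        IsFiniteMeasure p.1 ∧ Integrable (fun x => ‖x‖) p.1 ∧ IsFiniteMeasure p.2 ∧
        ∀ f, F f = LogConcaveRiesz.rieszFunctional p.1 p.2 f) ∧
    (∀ (μ : Measure (LogConcaveRiesz.E n)) (ν : Measure (LogConcaveRiesz.S n)),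
      IsFiniteMeasure μ → Integrable (fun x => ‖x‖) μ → IsFiniteMeasure ν →
      ∀ F : LogConcaveRiesz.LC n → EReal,
      (∀ f, F f = LogConcaveRiesz.rieszFunctional μ ν f) →
        (∀ f, F f ≠ ⊥) ∧
        LogConcaveRiesz.IsSupLinear F ∧
        LogConcaveRiesz.IsClosedSupLinear F ∧
        LogConcaveRiesz.IsIncreasing F ∧
        (∃ f₀ : LogConcaveRiesz.LC n, 0 < ∫⁻ x, (f₀ x : ℝ≥0∞) ∧ F f₀ < ⊤) ∧
        LogConcaveRiesz.IsContinuousFromBelow F) := by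
  refine ⟨fun F hbot hlin hinc h₀ hcont => ?_, fun μ ν hμ hμ' hν F hF => ?_⟩
  · obtain ⟨μ, ν, hμ, hμ', hν, hF⟩ :=
      LogConcaveRiesz.exists_rieszFunctional hbot hlin hinc h₀ hcont
    refine ⟨(μ, ν), ⟨hμ, hμ', hν, hF⟩, ?_⟩
    rintro ⟨μ₁, ν₁⟩ ⟨hμ₁, hμ₁', hν₁, hF₁⟩
    dsimp only at hμ₁ hμ₁' hν₁ hF₁
    obtain ⟨rfl, rfl⟩ := LogConcaveRiesz.rieszFunctional_injective hμ₁' hμ'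
      fun f => (hF₁ f).symm.trans (hF f)
    rfl
  · obtain rfl : F = LogConcaveRiesz.rieszFunctional μ ν := funext hF
    have hlin := LogConcaveRiesz.isClosedSupLinear_rieszFunctional (ν := ν) hμ'
    refine ⟨LogConcaveRiesz.rieszFunctional_ne_bot hμ', hlin.isSupLinear, hlin,
      LogConcaveRiesz.isIncreasing_rieszFunctional hμ', ?_,
      LogConcaveRiesz.isContinuousFromBelow_rieszFunctional hμ'⟩
    refine ⟨(LogConcaveRiesz.Body.disc 0 zero_le_one 0).toLC,
      LogConcaveRiesz.Body.lintegral_toLC_disc_pos 0 one_pos 0, ?_⟩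
    rw [LogConcaveRiesz.Body.rieszFunctional_toLC hμ']
    exact EReal.coe_lt_top _
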